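/- **Proposition A.1.** Let $n>2$ and let $(\Sigma,\gamma)$ be a connected smooth Riemannian $n$-manifold that is locally conformally flat, i.e. every point of $\Sigma$ lies in the domain of a conformal map into the round sphere $\mathbb{S}^n$. Here a *conformal map* is a diffeomorphism $\chi$ of an open set $U$ onto an open image such that the pullback of the target metric is $\omega^2$ times the metric on $U$, for some positive smooth function $\omega$ on $U$. A *local conformal Killing vector field* (local CKVF) of $(\Sigma,\gamma)$ is a smooth vector field $\xi$ on a non-empty connected open set $V\subset\Sigma$ with $\mathcal{L}_\xi\gamma=2f\gamma$ for some function $f$ on $V$. Say that $(V',\xi')$ is *generated by* $(V,\xi)$ if there is a conformal map $\phi$ from a non-empty open set $U\subset V$ onto an open set $\phi(U)\subset V'$ with $\phi_\star(\xi|_U)=\xi'|_{\phi(U)}$. The *local conformal classes* of $(\Sigma,\gamma)$ are the classes of local CKVFs under the equivalence relation generated by this relation. The *global conformal classes* of $\mathbb{S}^n$ are the classes of CKVFs $\zeta$ defined on all of $\mathbb{S}^n$, where $\zeta\sim\zeta'$ if $\psi_\star\zeta=\zeta'$ for some conformal diffeomorphism $\psi$ of $\mathbb{S}^n$ onto itself.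 Then for every local CKVF $(V,\xi)$, every conformal map $\chi:U\to\mathbb{S}^n$ with $U\subset\Sigma$ open, and every $p\in U\cap V$, there is exactly one CKVF $\zeta$ of $\mathbb{S}^n$ that agrees with $\chi_\star\xi$ in a neighbourhood of $\chi(p)$. The global conformal class of $\zeta$ depends only on the local conformal class of $\xi$, and the resulting map $[\xi]\mapsto[\zeta]$ is a bijection from the local conformal classes of CKVFs of $(\Sigma,\gamma)$ onto the global conformal classes of CKVFs of $\mathbb{S}^n$. -/

import Mathlib

open Set Filter Topology Bundle
open scoped Manifold ContDiff

noncomputable section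

namespace ConformalClasses

/-- The unit sphere `𝕊ⁿ` of `ℝⁿ⁺¹`. -/
abbrev Sphere (n : ℕ) : Type := Metric.sphere (0 : EuclideanSpace ℝ (Fin (n + 1))) 1

/-- A smooth Riemannian metric on an `n`-dimensional smooth manifold `M`. -/
abbrev RiemMetric (n : ℕ) (M : Type*) [TopologicalSpace M]
    [ChartedSpace (EuclideanSpace ℝ (Fin n)) M] [IsManifold (𝓡 n) ∞ M] :=
  ContMDiffRiemannianMetric (𝓡 n) ∞ (EuclideanSpace ℝ (Fin n))
    (fun x : M => TangentSpace (𝓡 n) x)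

/-! ### The round metric -/

/-- The differential at `x` of the inclusion `𝕊ⁿ ⊆ ℝⁿ⁺¹`. -/
def sphereInclDeriv (n : ℕ) (x : Sphere n) :
    TangentSpace (𝓡 n) x →L[ℝ] EuclideanSpace ℝ (Fin (n + 1)) :=
  mvfderiv (𝓡 n) (Subtype.val : Sphere n → EuclideanSpace ℝ (Fin (n + 1))) x

theorem sphereInclDeriv_injective (n : ℕ) (x : Sphere n) :
    Function.Injective (sphereInclDeriv n x) := by
  have := Fact.mk (@finrank_euclideanSpace_fin ℝ _ (n + 1))
  exact injective_mvfderiv_subtypeVal_sphere x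

/-- The bilinear form `(v, w) ↦ ⟪A v, A w⟫`. -/
def pullInner {E F : Type*} [AddCommGroup E] [TopologicalSpace E] [Module ℝ E]
    [IsTopologicalAddGroup E] [ContinuousSMul ℝ E]
    [NormedAddCommGroup F] [InnerProductSpace ℝ F] (A : E →L[ℝ] F) : E →L[ℝ] E →L[ℝ] ℝ :=
  (ContinuousLinearMap.precomp ℝ A).comp ((innerSL ℝ : F →L[ℝ] F →L[ℝ] ℝ).comp A)

theorem pullInner_apply {E F : Type*} [AddCommGroup E] [TopologicalSpace E] [Module ℝ E]
    [IsTopologicalAddGroup E] [ContinuousSMul ℝ E]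
    [NormedAddCommGroup F] [InnerProductSpace ℝ F] (A : E →L[ℝ] F) (v w : E) :
    pullInner A v w = inner ℝ (A v) (A w) := rfl

theorem contDiff_pullInner {E F : Type*} [NormedAddCommGroup E] [NormedSpace ℝ E]
    [FiniteDimensional ℝ E] [NormedAddCommGroup F] [InnerProductSpace ℝ F] :
    ContDiff ℝ ∞ (fun A : E →L[ℝ] F => pullInner A) := by
  refine contDiff_clm_apply_iff.2 fun v => contDiff_clm_apply_iff.2 fun w => ?_
  simp only [pullInner_apply]
  exact (contDiff_id.clm_apply contDiff_const).inner ℝ (contDiff_id.clm_apply contDiff_const)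

/-- The round metric of the unit sphere, induced by the Euclidean metric of `ℝⁿ⁺¹`. -/
def roundMetric (n : ℕ) : RiemMetric n (Sphere n) where
  inner x := pullInner (sphereInclDeriv n x)
  symm x v w := by rw [pullInner_apply, pullInner_apply, real_inner_comm]
  pos x v hv := real_inner_self_pos.2 fun h =>
    hv (sphereInclDeriv_injective n x (h.trans (map_zero _).symm))
  isVonNBounded x := by
    let A : EuclideanSpace ℝ (Fin n) →L[ℝ] EuclideanSpace ℝ (Fin (n + 1)) := sphereInclDeriv n x
    obtain ⟨K, -, hK⟩ := LinearMap.exists_antilipschitzWith A.toLinearMap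
      (LinearMap.ker_eq_bot.2 (sphereInclDeriv_injective n x))
    change Bornology.IsVonNBounded ℝ {v : EuclideanSpace ℝ (Fin n) | inner ℝ (A v) (A v) < 1}
    refine (NormedSpace.isVonNBounded_closedBall ℝ (EuclideanSpace ℝ (Fin n)) K).subset ?_
    intro v hv
    have h1 : ‖A v‖ ≤ 1 := by
      have hv' : inner ℝ (A v) (A v) < 1 := hv
      rw [real_inner_self_eq_norm_sq] at hv'
      nlinarith [norm_nonneg (A v)]
    have h2 := hK.le_mul_dist v 0
    rw [map_zero, dist_zero_right, dist_zero_right] at h2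
    rw [mem_closedBall_zero_iff]
    calc ‖v‖ ≤ K * ‖A v‖ := h2
      _ ≤ K * 1 := by gcongr
      _ = K := mul_one _
  contMDiff := by
    have := Fact.mk (@finrank_euclideanSpace_fin ℝ _ (n + 1))
    intro x₀
    have hD := ((contMDiff_coe_sphere (m := ∞)
      (E := EuclideanSpace ℝ (Fin (n + 1))) (n := n)) x₀).mfderiv_const (m := ∞) le_rfl
    have hD' := (contDiff_pullInner.contMDiff (n := ∞)).contMDiffAt.comp x₀ hD
    rw [contMDiffAt_hom_bundle]
    refine ⟨contMDiffAt_id, hD'.congr_of_eventuallyEq ?_⟩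
    filter_upwards [(trivializationAt (EuclideanSpace ℝ (Fin n))
      (TangentSpace (𝓡 n) : Sphere n → Type _) x₀).open_baseSet.mem_nhds
      (FiberBundle.mem_baseSet_trivializationAt' x₀)] with x hx
    ext v w
    erw [inCoordinates_apply_eq₂ hx hx (by simp)]
    have hy : ∀ u : EuclideanSpace ℝ (Fin n), inTangentCoordinates (𝓡 n) (𝓡 (n + 1)) id
        (Subtype.val : Sphere n → EuclideanSpace ℝ (Fin (n + 1)))
        (mfderiv (𝓡 n) (𝓡 (n + 1)) Subtype.val) x₀ x u = sphereInclDeriv n x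
          ((trivializationAt (EuclideanSpace ℝ (Fin n)) (TangentSpace (𝓡 n)) x₀).symm x u) := by
      intro u
      simp only [inTangentCoordinates, ContinuousLinearMap.inCoordinates,
        TangentBundle.continuousLinearMapAt_model_space]
      exact congrArg (sphereInclDeriv n x) (Trivialization.symmL_apply _ hx _)
    refine Eq.trans ?_ (congrArg₂ (inner ℝ) (hy v) (hy w)).symm
    simp [pullInner_apply]

/-! ### Conformal maps -/

section

variable {n : ℕ}
  {M : Type*} [TopologicalSpace M] [ChartedSpace (EuclideanSpace ℝ (Fin n)) M]
  [IsManifold (𝓡 n) ∞ M]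
  {N : Type*} [TopologicalSpace N] [ChartedSpace (EuclideanSpace ℝ (Fin n)) N]
  [IsManifold (𝓡 n) ∞ N]
  {P : Type*} [TopologicalSpace P] [ChartedSpace (EuclideanSpace ℝ (Fin n)) P]
  [IsManifold (𝓡 n) ∞ P]

/-- `φ^* γ' = a² γ` on `s`, for some positive smooth function `a` on `s`. -/
def IsConformalOn (γ : RiemMetric n M) (γ' : RiemMetric n N) (φ : M → N) (s : Set M) : Prop :=
  ∃ a : M → ℝ, ContMDiffOn (𝓡 n) 𝓘(ℝ, ℝ) ∞ a s ∧ ∀ x ∈ s, 0 < a x ∧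
    ∀ u v : TangentSpace (𝓡 n) x,
      γ'.inner (φ x) (mfderiv (𝓡 n) (𝓡 n) φ x u) (mfderiv (𝓡 n) (𝓡 n) φ x v) =
        a x ^ 2 * γ.inner x u v

/-- The pushforward of `Y|_s` by `φ` is the restriction of `Y'` to `φ(s)`. -/
def PushesForward (φ : M → N) (s : Set M) (Y : ∀ x : M, TangentSpace (𝓡 n) x)
    (Y' : ∀ x : N, TangentSpace (𝓡 n) x) : Prop :=
  ∀ x ∈ s, mfderiv (𝓡 n) (𝓡 n) φ x (Y x) = Y' (φ x)

/-- A conformal map from an open subset of `M` (the source) to `N`: a diffeomorphism onto its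
open image that is conformal. For `N = M` these are the local conformal diffeomorphisms. -/
structure ConfLoc (γ : RiemMetric n M) (γ' : RiemMetric n N) where
  /-- the map, as a diffeomorphism of its source onto its image (the target) -/
  toDiffeo : PartialDiffeomorph (𝓡 n) (𝓡 n) M N ∞
  isConformal : IsConformalOn γ γ' toDiffeo toDiffeo.source

/-- A Riemannian manifold is locally conformally flat if it is covered by the domains of
conformal maps to the round sphere. -/
def IsLocallyConformallyFlat (γ : RiemMetric n M) : Prop :=
  ∀ x : M, ∃ χ : ConfLoc γ (roundMetric n), x ∈ χ.toDiffeo.source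

/-! ### Conformal Killing vector fields -/

/-- The vector field `Y` is a conformal Killing vector field of `γ` on the open set `V`: it is
smooth there and `𝓛_Y γ = 2 f γ` for some function `f`, where
`(𝓛_Y γ)(X, Z) = Y (γ (X, Z)) - γ ([Y, X], Z) - γ (X, [Y, Z])`
for vector fields `X`, `Z` that are smooth near the point considered. -/
def IsCKVFOn (γ : RiemMetric n M) (Y : ∀ x : M, TangentSpace (𝓡 n) x) (V : Set M) : Prop :=
  ContMDiffOn (𝓡 n) (𝓡 n).tangent ∞
    (fun x => (⟨x, Y x⟩ : TangentBundle (𝓡 n) M)) V ∧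
  ∃ f : M → ℝ, ∀ x ∈ V, ∀ X Z : ∀ y : M, TangentSpace (𝓡 n) y,
    ContMDiffAt (𝓡 n) (𝓡 n).tangent ∞ (fun y => (⟨y, X y⟩ : TangentBundle (𝓡 n) M)) x →
    ContMDiffAt (𝓡 n) (𝓡 n).tangent ∞ (fun y => (⟨y, Z y⟩ : TangentBundle (𝓡 n) M)) x →
    mvfderiv (𝓡 n) (fun y => γ.inner y (X y) (Z y)) x (Y x)
        - γ.inner x (VectorField.mlieBracket (𝓡 n) Y X x) (Z x)
        - γ.inner x (X x) (VectorField.mlieBracket (𝓡 n) Y Z x) =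
      2 * f x * γ.inner x (X x) (Z x)

/-- A local conformal Killing vector field, defined on a domain (a non-empty connected open
set); the values of `field` outside `domain` are irrelevant. -/
structure LocalCKVF (γ : RiemMetric n M) where
  /-- the domain of definition -/
  domain : Set M
  isOpen : IsOpen domain
  isConnected : IsConnected domain
  /-- the vector field -/
  field : ∀ x : M, TangentSpace (𝓡 n) x
  isCKVF : IsCKVFOn γ field domain

/-- A global conformal Killing vector field. -/
structure GlobalCKVF (γ : RiemMetric n M) where
  /-- the vector field -/
  field : ∀ x : M, TangentSpace (𝓡 n) x
  isCKVF : IsCKVFOn γ field univ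

/-! ### Conformal classes -/

/-- `Y'` is generated from `Y` by a local conformal diffeomorphism: there is a local conformal
diffeomorphism `φ` with non-empty domain `U` inside the domain of `Y` and with `φ(U)` inside the
domain of `Y'`, such that `φ_* (Y|_U) = Y'|_{φ(U)}`. -/
def LocallyConformal (γ : RiemMetric n M) (Y Y' : LocalCKVF γ) : Prop :=
  ∃ φ : ConfLoc γ γ, φ.toDiffeo.source.Nonempty ∧ φ.toDiffeo.source ⊆ Y.domain ∧
    φ.toDiffeo.target ⊆ Y'.domain ∧
    PushesForward φ.toDiffeo φ.toDiffeo.source Y.field Y'.field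

/-- The equivalence relation generated by `LocallyConformal`; its classes are the local
conformal classes. -/
def localSetoid (γ : RiemMetric n M) : Setoid (LocalCKVF γ) :=
  Relation.EqvGen.setoid (LocallyConformal γ)

/-- `ψ_* ζ = ζ'` for a global conformal diffeomorphism `ψ`. -/
def GloballyConformal (γ : RiemMetric n M) (ζ ζ' : GlobalCKVF γ) : Prop :=
  ∃ ψ : Diffeomorph (𝓡 n) (𝓡 n) M M ∞, IsConformalOn γ γ ψ univ ∧
    PushesForward ψ univ ζ.field ζ'.field

theorem globallyConformal_refl (γ : RiemMetric n M) (ζ : GlobalCKVF γ) :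
    GloballyConformal γ ζ ζ := by
  refine ⟨Diffeomorph.refl _ _ _, ⟨fun _ => 1, contMDiffOn_const, fun x _ => ?_⟩, fun x _ => ?_⟩
  · refine ⟨one_pos, fun u v => ?_⟩
    simp only [Diffeomorph.coe_refl, mfderiv_id, id_eq, one_pow, one_mul]
    rfl
  · simp only [Diffeomorph.coe_refl, mfderiv_id, id_eq]
    rfl

theorem globallyConformal_symm (γ : RiemMetric n M) {ζ ζ' : GlobalCKVF γ}
    (h : GloballyConformal γ ζ ζ') : GloballyConformal γ ζ' ζ := by
  obtain ⟨ψ, ⟨a, ha, hc⟩, hp⟩ := h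
  have hinv : ∀ y, ∀ w : TangentSpace (𝓡 n) y,
      mfderiv (𝓡 n) (𝓡 n) ψ (ψ.symm y) (mfderiv (𝓡 n) (𝓡 n) ψ.symm y w) = w := by
    intro y w
    have h1 := mfderiv_comp y (ψ.contMDiff.mdifferentiableAt (x := ψ.symm y) (by simp))
      (ψ.symm.contMDiff.mdifferentiableAt (x := y) (by simp))
    have h2 : (ψ ∘ ψ.symm : M → M) = id := funext ψ.apply_symm_apply
    rw [h2, mfderiv_id] at h1
    exact (DFunLike.congr_fun h1 w).symm
  have hpos : ∀ x, 0 < a x := fun x => (hc x trivial).1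
  refine ⟨ψ.symm, ⟨fun y => (a (ψ.symm y))⁻¹, ?_, fun y _ => ⟨inv_pos.2 (hpos _), fun u v => ?_⟩⟩,
    fun y _ => ?_⟩
  · exact (((contMDiffOn_univ.1 ha).comp ψ.symm.contMDiff).inv₀
      fun y => (hpos _).ne').contMDiffOn
  · have h3 := (hc (ψ.symm y) trivial).2 (mfderiv (𝓡 n) (𝓡 n) ψ.symm y u)
      (mfderiv (𝓡 n) (𝓡 n) ψ.symm y v)
    erw [hinv, hinv, ψ.apply_symm_apply] at h3
    have := (hpos (ψ.symm y)).ne'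
    rw [h3]
    field_simp
  · obtain ⟨x, rfl⟩ := ψ.surjective y
    have h1 := mfderiv_comp x (ψ.symm.contMDiff.mdifferentiableAt (x := ψ x) (by simp))
      (ψ.contMDiff.mdifferentiableAt (x := x) (by simp))
    have h2 : (ψ.symm ∘ ψ : M → M) = id := funext ψ.symm_apply_apply
    rw [h2, mfderiv_id] at h1
    have h3 : ∀ z, z = x → (ζ.field z : EuclideanSpace ℝ (Fin n)) = ζ.field x := by
      rintro z rfl
      rfl
    refine (congrArg (mfderiv (𝓡 n) (𝓡 n) ψ.symm (ψ x)) (hp x trivial)).symm.trans ?_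
    exact (DFunLike.congr_fun h1 (ζ.field x)).symm.trans (h3 _ (ψ.symm_apply_apply x)).symm

theorem globallyConformal_trans (γ : RiemMetric n M) {ζ ζ' ζ'' : GlobalCKVF γ}
    (h : GloballyConformal γ ζ ζ') (h' : GloballyConformal γ ζ' ζ'') :
    GloballyConformal γ ζ ζ'' := by
  obtain ⟨ψ, ⟨a, ha, hc⟩, hp⟩ := h
  obtain ⟨ψ', ⟨a', ha', hc'⟩, hp'⟩ := h'
  have hcomp : ∀ x, ∀ u : TangentSpace (𝓡 n) x, mfderiv (𝓡 n) (𝓡 n) (ψ.trans ψ') x u =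
      mfderiv (𝓡 n) (𝓡 n) ψ' (ψ x) (mfderiv (𝓡 n) (𝓡 n) ψ x u) := by
    intro x u
    have := mfderiv_comp x (ψ'.contMDiff.mdifferentiableAt (x := ψ x) (by simp))
      (ψ.contMDiff.mdifferentiableAt (x := x) (by simp))
    rw [Diffeomorph.coe_trans, this]
    rfl
  refine ⟨ψ.trans ψ', ⟨fun x => a' (ψ x) * a x, ?_, fun x _ => ⟨?_, fun u v => ?_⟩⟩,
    fun x _ => ?_⟩
  · exact ((contMDiffOn_univ.1 ha').comp ψ.contMDiff).contMDiffOn.mul ha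
  · exact mul_pos (hc' _ trivial).1 (hc _ trivial).1
  · rw [hcomp, hcomp]
    erw [(hc' (ψ x) trivial).2, (hc x trivial).2]
    ring
  · rw [hcomp, hp x trivial]
    exact hp' _ trivial

/-- The classes of this equivalence relation are the global conformal classes. -/
def globalSetoid (γ : RiemMetric n M) : Setoid (GlobalCKVF γ) where
  r := GloballyConformal γ
  iseqv := ⟨globallyConformal_refl γ, globallyConformal_symm γ, globallyConformal_trans γ⟩

/-- The vector field `ζ` of the sphere is assigned to `Y` by `χ` at `p`: one has
`χ_* Y = ζ` near `χ p`. -/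
def AssignedAt {γ : RiemMetric n M} (Y : LocalCKVF γ) (χ : ConfLoc γ (roundMetric n)) (p : M)
    (ζ : GlobalCKVF (roundMetric n)) : Prop :=
  ∃ U : Set M, IsOpen U ∧ p ∈ U ∧ U ⊆ Y.domain ∩ χ.toDiffeo.source ∧
    PushesForward χ.toDiffeo U Y.field ζ.field

end

end ConformalClasses

end

open ConformalClasses

noncomputable section

namespace ConformalClasses

open scoped InnerProductSpace

set_option linter.unusedSectionVars false

/-! Everything reduces to two rigidity statements on the sphere. A conformal Killing field near a
point of the sphere extends uniquely to the whole sphere (`exists_global_eventuallyEq`,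
`global_ext_of_eventuallyEq`), and a local conformal map of the sphere agrees near each point of its
domain with a global conformal diffeomorphism (`exists_diffeomorph_eventuallyEq`).

Fields: in stereographic coordinates the round metric is conformally flat. Prolonging the flat
conformal Killing equation in dimension at least three shows that the conformal factor is affine, so
the field is a quadratic polynomial (`exists_eqOn_quadField_of_killing`). Such a polynomial is the
chart expression of an infinitesimal Lorentz transformation acting on null directions, hence global
(`exists_global_of_quadField`). Uniqueness follows because polynomials with the same germ coincide.

Maps: the finite Liouville theorem is deduced from the infinitesimal one. Write the map in charts as
`F` with `F 0 = 0`, and push the Euler field `x ↦ x` forward by `F`. The result is conformal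
Killing, hence quadratic, and an explicit special conformal transformation straightens it back to
the Euler field. The composite commutes with dilations, so it is linear and a similarity
(`eventually_specialMap_eq`). Hence `F` is induced by a Lorentz transformation up to scale
(`exists_diffeomorph_special`).

Classes: transporting a local field by two charts at one point gives fields related by a local
conformal map of the sphere, hence globally equivalent ones (`globallyConformal_of_pushesNear`).
Connectedness of the domain removes the dependence on the point, so the map is well defined.
Surjectivity is pullback by a chart. For injectivity, two local fields with the same image `ζ` at
the same point of the sphere are related by composing charts. Different points are joined through
intermediate local fields, using that the sphere is connected and that every point of it can be
reached from `M` (`TransportsTo.eqvGen`). -/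

/-- The model space of `n`-dimensional manifolds. -/
abbrev Model (n : ℕ) : Type := EuclideanSpace ℝ (Fin n)

/-! ### Tangent vectors and fields with values in one fixed model space -/

section

variable {n : ℕ}
  {M : Type*} [TopologicalSpace M] [ChartedSpace (Model n) M] [IsManifold (𝓡 n) ∞ M]
  {N : Type*} [TopologicalSpace N] [ChartedSpace (Model n) N] [IsManifold (𝓡 n) ∞ N]
  {P : Type*} [TopologicalSpace P] [ChartedSpace (Model n) P] [IsManifold (𝓡 n) ∞ P]

/-- The value of a metric at a point, as a bilinear form on the model space. -/
def metricAt (γ : RiemMetric n M) (x : M) : Model n →L[ℝ] Model n →L[ℝ] ℝ := γ.inner x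

/-- The differential of a map, as a map of the model space. -/
def diffAt (n : ℕ) {M N : Type*} [TopologicalSpace M] [ChartedSpace (Model n) M]
    [TopologicalSpace N] [ChartedSpace (Model n) N] (φ : M → N) (x : M) : Model n →L[ℝ] Model n := mfderiv (𝓡 n) (𝓡 n) φ x

/-- The differential of a function, as a functional on the model space. -/
def dirAt (n : ℕ) {M : Type*} [TopologicalSpace M] [ChartedSpace (Model n) M]
    (f : M → ℝ) (x : M) : Model n →L[ℝ] ℝ := mvfderiv (𝓡 n) f x

/-- Smoothness at a point of a vector field with values in the model space. -/
def SmoothFieldAt (Y : M → Model n) (x : M) : Prop :=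
  ContMDiffAt (𝓡 n) (𝓡 n).tangent ∞
    (fun y => (⟨y, Y y⟩ : TangentBundle (𝓡 n) M)) x

/-- The Lie bracket of vector fields with values in the model space. -/
def bracketAt (Y X : M → Model n) (x : M) : Model n :=
  VectorField.mlieBracket (𝓡 n) (fun y => (Y y : TangentSpace (𝓡 n) y))
    (fun y => (X y : TangentSpace (𝓡 n) y)) x

/-- The pullback of a vector field with values in the model space. -/
def pullField (φ : M → N) (Y : N → Model n) (x : M) : Model n :=
  (diffAt n φ x).inverse (Y (φ x))

/-- The Lie derivative `(𝓛_Y γ)(X, Z)` at a point. -/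
def lieDerivAt (γ : RiemMetric n M) (Y X Z : M → Model n) (x : M) : ℝ :=
  dirAt n (fun y => metricAt γ y (X y) (Z y)) x (Y x)
    - metricAt γ x (bracketAt Y X x) (Z x) - metricAt γ x (X x) (bracketAt Y Z x)

theorem isCKVFOn_iff {γ : RiemMetric n M} {Y : M → Model n} {V : Set M} (hV : IsOpen V) :
    IsCKVFOn γ Y V ↔ (∀ x ∈ V, SmoothFieldAt Y x) ∧
      ∃ f : M → ℝ, ∀ x ∈ V, ∀ X Z : M → Model n, SmoothFieldAt X x → SmoothFieldAt Z x →
        lieDerivAt γ Y X Z x = 2 * f x * metricAt γ x (X x) (Z x) :=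
  and_congr ⟨fun h x hx => (h x hx).contMDiffAt (hV.mem_nhds hx),
    fun h x hx => (h x hx).contMDiffWithinAt⟩ Iff.rfl

theorem diffAt_comp {φ : M → N} {ψ : N → P} {x : M}
    (hψ : MDifferentiableAt (𝓡 n) (𝓡 n) ψ (φ x)) (hφ : MDifferentiableAt (𝓡 n) (𝓡 n) φ x) :
    diffAt n (ψ ∘ φ) x = (diffAt n ψ (φ x)).comp (diffAt n φ x) :=
  mfderiv_comp x hψ hφ

theorem diffAt_id (x : M) : diffAt n (id : M → M) x = ContinuousLinearMap.id ℝ (Model n) :=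
  mfderiv_id

theorem diffAt_congr {φ ψ : M → N} {x : M} (h : φ =ᶠ[𝓝 x] ψ) : diffAt n φ x = diffAt n ψ x :=
  h.mfderiv_eq

theorem diffAt_eq_fderiv (φ : Model n → Model n) (x : Model n) :
    diffAt n φ x = fderiv ℝ φ x := mfderiv_eq_fderiv

theorem dirAt_comp {φ : M → N} {f : N → ℝ} {x : M}
    (hf : MDifferentiableAt (𝓡 n) 𝓘(ℝ, ℝ) f (φ x)) (hφ : MDifferentiableAt (𝓡 n) (𝓡 n) φ x) :
    dirAt n (f ∘ φ) x = (dirAt n f (φ x)).comp (diffAt n φ x) :=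
  mvfderiv_comp x hf hφ

theorem dirAt_congr {f g : M → ℝ} {x : M} (h : f =ᶠ[𝓝 x] g) : dirAt n f x = dirAt n g x :=
  congrArg _ h.mfderiv_eq

theorem dirAt_mul {f g : M → ℝ} {x : M} (hf : MDifferentiableAt (𝓡 n) 𝓘(ℝ, ℝ) f x)
    (hg : MDifferentiableAt (𝓡 n) 𝓘(ℝ, ℝ) g x) (v : Model n) :
    dirAt n (fun y => f y * g y) x v = f x * dirAt n g x v + g x * dirAt n f x v := by
  have := congrArg (fun T : Model n →L[ℝ] ℝ => T v) (mvfderiv_mul (I := 𝓡 n) hf hg)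
  exact this

theorem bracketAt_congr {Y Y' X X' : M → Model n} {x : M} (hY : Y =ᶠ[𝓝 x] Y')
    (hX : X =ᶠ[𝓝 x] X') : bracketAt Y X x = bracketAt Y' X' x :=
  Filter.EventuallyEq.mlieBracket_vectorField_eq hY hX

theorem SmoothFieldAt.congr {Y Y' : M → Model n} {x : M} (h : SmoothFieldAt Y x)
    (hY : Y' =ᶠ[𝓝 x] Y) : SmoothFieldAt Y' x := by
  refine ContMDiffAt.congr_of_eventuallyEq h ?_
  filter_upwards [hY] with y hy
  rw [hy]

theorem SmoothFieldAt.mdifferentiableAt_metricAt {γ : RiemMetric n M} {X Z : M → Model n} {x : M}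
    (hX : SmoothFieldAt X x) (hZ : SmoothFieldAt Z x) :
    MDifferentiableAt (𝓡 n) 𝓘(ℝ, ℝ) (fun y => metricAt γ y (X y) (Z y)) x := by
  have h : ContMDiffAt (𝓡 n) ((𝓡 n).prod 𝓘(ℝ, ℝ)) ∞
      (fun y => (⟨y, γ.inner y (X y) (Z y)⟩ : TotalSpace ℝ (Bundle.Trivial M ℝ))) x := by
    apply ContMDiffAt.clm_bundle_apply₂ (F₁ := Model n) (F₂ := Model n)
    · exact γ.contMDiff x
    · exact hX
    · exact hZ
  simp only [contMDiffAt_totalSpace] at h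
  exact h.2.mdifferentiableAt (by simp)

theorem two_le_infty : (2 : WithTop ℕ∞) ≤ ∞ := ENat.LEInfty.out

theorem pullField_bracketAt {φ : M → N} {x : M} (hφ : ContMDiffAt (𝓡 n) (𝓡 n) ∞ φ x)
    {Y X : N → Model n} (hY : SmoothFieldAt Y (φ x)) (hX : SmoothFieldAt X (φ x)) :
    pullField φ (bracketAt Y X) x = bracketAt (pullField φ Y) (pullField φ X) x := by
  have : IsManifold (𝓡 n) (minSmoothness ℝ 2) M := by simpa using IsManifold.of_le two_le_infty
  have : IsManifold (𝓡 n) (minSmoothness ℝ 2) N := by simpa using IsManifold.of_le two_le_infty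
  exact VectorField.mpullback_mlieBracket (n := ∞) (hY.mdifferentiableAt (by simp))
    (hX.mdifferentiableAt (by simp)) hφ (by simpa using two_le_infty)

theorem SmoothFieldAt.pullField {φ : M → N} {x : M} (hφ : ContMDiffAt (𝓡 n) (𝓡 n) ∞ φ x)
    (hi : (diffAt n φ x).IsInvertible) {Y : N → Model n} (hY : SmoothFieldAt Y (φ x)) :
    SmoothFieldAt (pullField φ Y) x :=
  ContMDiffAt.mpullback_vectorField_preimage (m := ∞) (n := ∞) hY hφ hi (by simp)

theorem bracketAt_model (Y X : Model n → Model n) (x : Model n) :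
    bracketAt Y X x = fderiv ℝ X x (Y x) - fderiv ℝ Y x (X x) := by
  have := VectorField.mlieBracketWithin_eq_lieBracketWithin (𝕜 := ℝ) (V := Y) (W := X) (s := univ)
  erw [VectorField.mlieBracketWithin_univ, VectorField.lieBracketWithin_univ] at this
  exact congrFun this x

theorem smoothFieldAt_model {Y : Model n → Model n} {x : Model n} :
    SmoothFieldAt Y x ↔ ContDiffAt ℝ ∞ Y x :=
  contMDiffAt_vectorSpace_iff_contDiffAt

theorem dirAt_model (f : Model n → ℝ) (x : Model n) : dirAt n f x = fderiv ℝ f x := by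
  have : mfderiv (𝓡 n) 𝓘(ℝ, ℝ) f x = fderiv ℝ f x := mfderiv_eq_fderiv
  exact this

end

/-! ### Conformal maps and the transport of conformal Killing fields -/

section

variable {n : ℕ}
  {M : Type*} [TopologicalSpace M] [ChartedSpace (Model n) M] [IsManifold (𝓡 n) ∞ M]
  {N : Type*} [TopologicalSpace N] [ChartedSpace (Model n) N] [IsManifold (𝓡 n) ∞ N]
  {P : Type*} [TopologicalSpace P] [ChartedSpace (Model n) P] [IsManifold (𝓡 n) ∞ P]
  {γ : RiemMetric n M} {γ' : RiemMetric n N} {γ'' : RiemMetric n P}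

theorem contMDiffAt_partialDiffeo (Φ : PartialDiffeomorph (𝓡 n) (𝓡 n) M N ∞) {x : M}
    (hx : x ∈ Φ.source) : ContMDiffAt (𝓡 n) (𝓡 n) ∞ Φ x :=
  Φ.contMDiffOn.contMDiffAt (Φ.open_source.mem_nhds hx)

theorem mdifferentiableAt_partialDiffeo (Φ : PartialDiffeomorph (𝓡 n) (𝓡 n) M N ∞) {x : M}
    (hx : x ∈ Φ.source) : MDifferentiableAt (𝓡 n) (𝓡 n) Φ x :=
  (contMDiffAt_partialDiffeo Φ hx).mdifferentiableAt (by simp)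

theorem diffAt_symm_comp (Φ : PartialDiffeomorph (𝓡 n) (𝓡 n) M N ∞) {x : M}
    (hx : x ∈ Φ.source) :
    (diffAt n Φ.symm (Φ x)).comp (diffAt n Φ x) = ContinuousLinearMap.id ℝ (Model n) := by
  rw [← diffAt_comp (mdifferentiableAt_partialDiffeo Φ.symm (Φ.map_source hx))
    (mdifferentiableAt_partialDiffeo Φ hx), ← diffAt_id x]
  refine diffAt_congr ?_
  filter_upwards [Φ.open_source.mem_nhds hx] with y hy
  exact Φ.left_inv hy

theorem diffAt_symm_diffAt (Φ : PartialDiffeomorph (𝓡 n) (𝓡 n) M N ∞) {x : M}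
    (hx : x ∈ Φ.source) (u : Model n) : diffAt n Φ.symm (Φ x) (diffAt n Φ x u) = u :=
  congrArg (fun T : Model n →L[ℝ] Model n => T u) (diffAt_symm_comp Φ hx)

theorem diffAt_diffAt_symm' (Φ : PartialDiffeomorph (𝓡 n) (𝓡 n) M N ∞) {y : N}
    (hy : y ∈ Φ.target) (u : Model n) : diffAt n Φ (Φ.symm y) (diffAt n Φ.symm y u) = u :=
  diffAt_symm_diffAt Φ.symm hy u

theorem diffAt_diffAt_symm (Φ : PartialDiffeomorph (𝓡 n) (𝓡 n) M N ∞) {x : M}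
    (hx : x ∈ Φ.source) (u : Model n) : diffAt n Φ x (diffAt n Φ.symm (Φ x) u) = u := by
  have h := diffAt_diffAt_symm' Φ (Φ.map_source hx) u
  have hx' : Φ.symm (Φ x) = x := Φ.left_inv hx
  rwa [hx'] at h

theorem inverse_diffAt (Φ : PartialDiffeomorph (𝓡 n) (𝓡 n) M N ∞) {x : M}
    (hx : x ∈ Φ.source) : (diffAt n Φ x).inverse = diffAt n Φ.symm (Φ x) :=
  ContinuousLinearMap.inverse_eq (ContinuousLinearMap.ext (diffAt_diffAt_symm Φ hx))
    (diffAt_symm_comp Φ hx)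

theorem isInvertible_diffAt (Φ : PartialDiffeomorph (𝓡 n) (𝓡 n) M N ∞) {x : M}
    (hx : x ∈ Φ.source) : (diffAt n Φ x).IsInvertible :=
  ⟨ContinuousLinearEquiv.equivOfInverse (diffAt n Φ x) (diffAt n Φ.symm (Φ x))
    (diffAt_symm_diffAt Φ hx) (diffAt_diffAt_symm Φ hx), rfl⟩

theorem diffAt_pullField (Φ : PartialDiffeomorph (𝓡 n) (𝓡 n) M N ∞) {x : M}
    (hx : x ∈ Φ.source) (Y : N → Model n) : diffAt n Φ x (pullField Φ Y x) = Y (Φ x) := by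
  rw [pullField, inverse_diffAt Φ hx, diffAt_diffAt_symm Φ hx]

theorem smoothFieldAt_pullField (Φ : PartialDiffeomorph (𝓡 n) (𝓡 n) M N ∞) {x : M}
    (hx : x ∈ Φ.source) {Y : N → Model n} (hY : SmoothFieldAt Y (Φ x)) :
    SmoothFieldAt (pullField Φ Y) x :=
  hY.pullField (contMDiffAt_partialDiffeo Φ hx) (isInvertible_diffAt Φ hx)

/-- Near `Φ x` the field `Y'` is the pullback of `Y` by the inverse map, so its smoothness need not
be assumed. -/
theorem smoothFieldAt_push (Φ : PartialDiffeomorph (𝓡 n) (𝓡 n) M N ∞) {x : M}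
    (hx : x ∈ Φ.source) {Y : M → Model n} {Y' : N → Model n} (hY : SmoothFieldAt Y x)
    (h : ∀ᶠ y in 𝓝 x, diffAt n Φ y (Y y) = Y' (Φ y)) : SmoothFieldAt Y' (Φ x) := by
  have hx' : Φ.symm (Φ x) = x := Φ.left_inv hx
  refine (smoothFieldAt_pullField Φ.symm (Φ.map_source hx) (Y := Y) (hx'.symm ▸ hY)).congr ?_
  have hc : Tendsto Φ.symm (𝓝 (Φ x)) (𝓝 x) := by
    have := (contMDiffAt_partialDiffeo Φ.symm (Φ.map_source hx)).continuousAt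
    rwa [ContinuousAt, hx'] at this
  filter_upwards [hc.eventually h, Φ.open_target.mem_nhds (Φ.map_source hx)] with y hy hyt
  have hy' : Φ (Φ.symm y) = y := Φ.right_inv hyt
  rw [hy'] at hy
  rw [pullField, inverse_diffAt Φ.symm hyt, ← hy]
  rfl

/-- Brackets are natural under diffeomorphisms, so this is the Leibniz rule for `𝓛_Y (a γ)`, where
`a γ` is the pullback of `γ'`. Here `a` is the full factor, not its square root. -/
theorem lieDerivAt_push (Φ : PartialDiffeomorph (𝓡 n) (𝓡 n) M N ∞) {a : M → ℝ} {x : M}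
    (hx : x ∈ Φ.source) (ha : MDifferentiableAt (𝓡 n) 𝓘(ℝ, ℝ) a x)
    (hΦ : ∀ y ∈ Φ.source, ∀ u v : Model n,
      metricAt γ' (Φ y) (diffAt n Φ y u) (diffAt n Φ y v) = a y * metricAt γ y u v)
    {Y : M → Model n} {Y' X Z : N → Model n}
    (h : ∀ᶠ y in 𝓝 x, diffAt n Φ y (Y y) = Y' (Φ y)) (hY : SmoothFieldAt Y x)
    (hX : SmoothFieldAt X (Φ x)) (hZ : SmoothFieldAt Z (Φ x)) :
    lieDerivAt γ' Y' X Z (Φ x) = a x * lieDerivAt γ Y (pullField Φ X) (pullField Φ Z) x +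
      dirAt n a x (Y x) * metricAt γ x (pullField Φ X x) (pullField Φ Z x) := by
  have hY' := smoothFieldAt_push Φ hx hY h
  have hs := Φ.open_source.mem_nhds hx
  have hYe : Y =ᶠ[𝓝 x] pullField Φ Y' := by
    filter_upwards [h, hs] with y hy hys
    rw [pullField, inverse_diffAt Φ hys, ← hy, diffAt_symm_diffAt Φ hys]
  have hXp := smoothFieldAt_pullField Φ hx hX
  have hZp := smoothFieldAt_pullField Φ hx hZ
  have hbr : ∀ W : N → Model n, SmoothFieldAt W (Φ x) →
      bracketAt Y' W (Φ x) = diffAt n Φ x (bracketAt Y (pullField Φ W) x) := by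
    intro W hW
    rw [bracketAt_congr hYe EventuallyEq.rfl,
      ← pullField_bracketAt (contMDiffAt_partialDiffeo Φ hx) hY' hW, diffAt_pullField Φ hx]
  have h1 : dirAt n (fun y => metricAt γ' y (X y) (Z y)) (Φ x) (Y' (Φ x)) =
      a x * dirAt n (fun y => metricAt γ y (pullField Φ X y) (pullField Φ Z y)) x (Y x) +
        metricAt γ x (pullField Φ X x) (pullField Φ Z x) * dirAt n a x (Y x) := by
    rw [← dirAt_mul ha (hXp.mdifferentiableAt_metricAt hZp), ← h.self_of_nhds]
    refine (congrArg (fun T : Model n →L[ℝ] ℝ => T (Y x))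
      (dirAt_comp (hX.mdifferentiableAt_metricAt hZ) (mdifferentiableAt_partialDiffeo Φ hx))).symm.trans ?_
    refine congrArg (fun T : Model n →L[ℝ] ℝ => T (Y x)) (dirAt_congr ?_)
    filter_upwards [hs] with y hy
    rw [← hΦ y hy, diffAt_pullField Φ hy, diffAt_pullField Φ hy]
    rfl
  rw [lieDerivAt, lieDerivAt, h1, hbr X hX, hbr Z hZ]
  have h2 := hΦ x hx (bracketAt Y (pullField Φ X) x) (pullField Φ Z x)
  have h3 := hΦ x hx (pullField Φ X x) (bracketAt Y (pullField Φ Z) x)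
  rw [diffAt_pullField Φ hx] at h2 h3
  rw [h2, h3]
  ring

theorem isConformalOn_iff {φ : M → N} {s : Set M} :
    IsConformalOn γ γ' φ s ↔ ∃ a : M → ℝ, ContMDiffOn (𝓡 n) 𝓘(ℝ, ℝ) ∞ a s ∧ ∀ x ∈ s, 0 < a x ∧
      ∀ u v : Model n, metricAt γ' (φ x) (diffAt n φ x u) (diffAt n φ x v) =
        a x ^ 2 * metricAt γ x u v := Iff.rfl

theorem IsCKVFOn.push (φ : ConfLoc γ γ') {U : Set M} (hU : IsOpen U)
    (hUs : U ⊆ φ.toDiffeo.source) {Y : M → Model n} {Y' : N → Model n}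
    (hp : ∀ x ∈ U, diffAt n φ.toDiffeo x (Y x) = Y' (φ.toDiffeo x)) (h : IsCKVFOn γ Y U) :
    IsCKVFOn γ' Y' (φ.toDiffeo '' U) := by
  obtain ⟨a, ha, hc⟩ := isConformalOn_iff.1 φ.isConformal
  obtain ⟨hY, f, hf⟩ := (isCKVFOn_iff hU).1 h
  refine (isCKVFOn_iff
    (φ.toDiffeo.toOpenPartialHomeomorph.isOpen_image_of_subset_source hU hUs)).2 ⟨?_, ?_⟩
  · rintro _ ⟨x, hx, rfl⟩
    exact smoothFieldAt_push φ.toDiffeo (hUs hx) (hY x hx)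
      (eventually_of_mem (hU.mem_nhds hx) hp)
  -- The new factor comes from `𝓛_Y (a² γ) = (2 f a² + Y (a²)) γ` after division by `2 a²`.
  · let g : M → ℝ := fun x => f x + dirAt n (fun y => a y ^ 2) x (Y x) / (2 * a x ^ 2)
    refine ⟨fun y => g (φ.toDiffeo.symm y), ?_⟩
    rintro _ ⟨x, hx, rfl⟩ X Z hX hZ
    have hx' : φ.toDiffeo.symm (φ.toDiffeo x) = x := φ.toDiffeo.left_inv (hUs hx)
    have ha' : MDifferentiableAt (𝓡 n) 𝓘(ℝ, ℝ) (fun y => a y ^ 2) x := by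
      have := (ha x (hUs hx)).contMDiffAt (φ.toDiffeo.open_source.mem_nhds (hUs hx))
      exact (this.pow 2).mdifferentiableAt (by simp)
    have hpos := (hc x (hUs hx)).1
    have h1 := lieDerivAt_push (γ := γ) (γ' := γ') φ.toDiffeo (hUs hx) ha'
      (fun y hy => (hc y hy).2) (eventually_of_mem (hU.mem_nhds hx) hp) (hY x hx) hX hZ
    have h2 := (hc x (hUs hx)).2 (pullField φ.toDiffeo X x) (pullField φ.toDiffeo Z x)
    rw [diffAt_pullField _ (hUs hx), diffAt_pullField _ (hUs hx)] at h2
    change lieDerivAt γ' Y' X Z (φ.toDiffeo x) = 2 * g (φ.toDiffeo.symm (φ.toDiffeo x)) *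
      metricAt γ' (φ.toDiffeo x) (X (φ.toDiffeo x)) (Z (φ.toDiffeo x))
    simp only [hx', g]
    rw [h1, h2, hf x hx _ _ (smoothFieldAt_pullField _ (hUs hx) hX)
      (smoothFieldAt_pullField _ (hUs hx) hZ)]
    field_simp

/-- The inverse of a conformal map. -/
def ConfLoc.symm (φ : ConfLoc γ γ') : ConfLoc γ' γ where
  toDiffeo := φ.toDiffeo.symm
  isConformal := by
    obtain ⟨a, ha, hc⟩ := isConformalOn_iff.1 φ.isConformal
    refine isConformalOn_iff.2 ⟨fun y => (a (φ.toDiffeo.symm y))⁻¹, ?_, fun y hy => ?_⟩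
    · exact (ha.comp φ.toDiffeo.symm.contMDiffOn fun y hy => φ.toDiffeo.map_target hy).inv₀
        fun y hy => (hc _ (φ.toDiffeo.map_target hy)).1.ne'
    · have hys : φ.toDiffeo.symm y ∈ φ.toDiffeo.source := φ.toDiffeo.map_target hy
      obtain ⟨hpos, h⟩ := hc _ hys
      refine ⟨inv_pos.2 hpos, fun u v => ?_⟩
      have h1 := h (diffAt n φ.toDiffeo.symm y u) (diffAt n φ.toDiffeo.symm y v)
      have h2 := diffAt_diffAt_symm' φ.toDiffeo hy
      have hy' : φ.toDiffeo (φ.toDiffeo.symm y) = y := φ.toDiffeo.right_inv hy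
      rw [h2, h2, hy'] at h1
      rw [h1, inv_pow, inv_mul_cancel_left₀ (pow_ne_zero 2 hpos.ne')]

/-- The composition of conformal maps. -/
def ConfLoc.trans (φ : ConfLoc γ γ') (ψ : ConfLoc γ' γ'') : ConfLoc γ γ'' where
  toDiffeo := φ.toDiffeo.trans ψ.toDiffeo
  isConformal := by
    obtain ⟨a, ha, hc⟩ := isConformalOn_iff.1 φ.isConformal
    obtain ⟨b, hb, hd⟩ := isConformalOn_iff.1 ψ.isConformal
    refine isConformalOn_iff.2 ⟨fun x => b (φ.toDiffeo x) * a x, ?_, ?_⟩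
    · exact (hb.comp (φ.toDiffeo.contMDiffOn.mono inter_subset_left) inter_subset_right).mul
        (ha.mono inter_subset_left)
    · rintro x ⟨hx, hx'⟩
      refine ⟨mul_pos (hd _ hx').1 (hc x hx).1, fun u v => ?_⟩
      have h1 : diffAt n (φ.toDiffeo.trans ψ.toDiffeo) x =
          (diffAt n ψ.toDiffeo (φ.toDiffeo x)).comp (diffAt n φ.toDiffeo x) :=
        diffAt_comp (mdifferentiableAt_partialDiffeo ψ.toDiffeo hx')
          (mdifferentiableAt_partialDiffeo φ.toDiffeo hx)
      rw [h1]
      refine ((hd _ hx').2 _ _).trans ?_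
      change b (φ.toDiffeo x) ^ 2 * metricAt γ' (φ.toDiffeo x) (diffAt n φ.toDiffeo x u)
        (diffAt n φ.toDiffeo x v) = (b (φ.toDiffeo x) * a x) ^ 2 * metricAt γ x u v
      rw [(hc x hx).2]
      ring

theorem ConfLoc.diffAt_trans (φ : ConfLoc γ γ') (ψ : ConfLoc γ' γ'') {x : M}
    (hx : x ∈ φ.toDiffeo.source) (hx' : φ.toDiffeo x ∈ ψ.toDiffeo.source) :
    diffAt n (φ.trans ψ).toDiffeo x =
      (diffAt n ψ.toDiffeo (φ.toDiffeo x)).comp (diffAt n φ.toDiffeo x) :=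
  diffAt_comp (mdifferentiableAt_partialDiffeo ψ.toDiffeo hx')
    (mdifferentiableAt_partialDiffeo φ.toDiffeo hx)

/-- The restriction of a conformal map to an open set. -/
def ConfLoc.restr (φ : ConfLoc γ γ') (U : Set M) (hU : IsOpen U) : ConfLoc γ γ' where
  toDiffeo :=
    { toPartialEquiv := φ.toDiffeo.toPartialEquiv.restr U
      open_source := φ.toDiffeo.open_source.inter hU
      open_target := φ.toDiffeo.toOpenPartialHomeomorph.symm.isOpen_inter_preimage hU
      contMDiffOn_toFun := φ.toDiffeo.contMDiffOn_toFun.mono inter_subset_left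
      contMDiffOn_invFun := φ.toDiffeo.contMDiffOn_invFun.mono inter_subset_left }
  isConformal := by
    obtain ⟨a, ha, hc⟩ := φ.isConformal
    exact ⟨a, ha.mono inter_subset_left, fun x hx => hc x hx.1⟩

/-- The identity as a conformal map. -/
def ConfLoc.refl (γ : RiemMetric n M) : ConfLoc γ γ where
  toDiffeo := (Diffeomorph.refl (𝓡 n) M ∞).toPartialDiffeomorph
  isConformal := by
    refine isConformalOn_iff.2 ⟨fun _ => 1, contMDiffOn_const, fun x _ => ⟨one_pos, fun u v => ?_⟩⟩
    have h : diffAt n (Diffeomorph.refl (𝓡 n) M ∞).toPartialDiffeomorph x =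
      ContinuousLinearMap.id ℝ (Model n) := diffAt_id x
    rw [h, one_pow, one_mul]
    rfl

end

/-! ### Quadratic vector fields and linear algebra in dimension at least three -/

section

variable {n : ℕ}

/-- The quadratic vector field `a + B x + l x + 2 ⟪b, x⟫ x - ‖x‖² b`. -/
def quadField (a b : Model n) (l : ℝ) (B : Model n →L[ℝ] Model n) (x : Model n) : Model n :=
  a + B x + l • x + (2 * ⟪b, x⟫_ℝ) • x - (‖x‖ ^ 2) • b

/-- The derivative of `quadField`. -/
def quadDeriv (b : Model n) (l : ℝ) (B : Model n →L[ℝ] Model n) (x : Model n) :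
    Model n →L[ℝ] Model n :=
  B + l • ContinuousLinearMap.id ℝ (Model n) + (2 * ⟪b, x⟫_ℝ) • ContinuousLinearMap.id ℝ (Model n)
    + ((2 : ℝ) • innerSL ℝ b).smulRight x - ((2 : ℝ) • innerSL ℝ x).smulRight b

theorem quadDeriv_apply (b : Model n) (l : ℝ) (B : Model n →L[ℝ] Model n) (x u : Model n) :
    quadDeriv b l B x u = B u + l • u + (2 * ⟪b, x⟫_ℝ) • u + (2 * ⟪b, u⟫_ℝ) • x
      - (2 * ⟪x, u⟫_ℝ) • b := by
  simp [quadDeriv]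

theorem hasFDerivAt_quadField (a b : Model n) (l : ℝ) (B : Model n →L[ℝ] Model n) (x : Model n) :
    HasFDerivAt (quadField a b l B) (quadDeriv b l B x) x := by
  have h1 : HasFDerivAt (fun x : Model n => 2 * ⟪b, x⟫_ℝ) ((2 : ℝ) • innerSL ℝ b) x :=
    ((innerSL ℝ b).hasFDerivAt).const_mul 2
  have h2 := (hasStrictFDerivAt_norm_sq x).hasFDerivAt
  have h3 := ((((hasFDerivAt_const a x).add B.hasFDerivAt).add
    ((hasFDerivAt_id x).const_smul l)).add (h1.smul (hasFDerivAt_id x))).sub (h2.smul_const b)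
  refine h3.congr_fderiv ?_
  ext1 u
  simp [quadDeriv_apply]
  abel

theorem contDiff_quadField (a b : Model n) (l : ℝ) (B : Model n →L[ℝ] Model n) :
    ContDiff ℝ ∞ (quadField a b l B) := by
  unfold quadField
  exact (((contDiff_const.add B.contDiff).add (contDiff_id.const_smul l)).add
    ((contDiff_const.mul (contDiff_const.inner ℝ contDiff_id)).smul contDiff_id)).sub
    ((contDiff_id.norm_sq ℝ).smul contDiff_const)

/-- The operator `B` is skew-symmetric. -/
def IsSkew (B : Model n →L[ℝ] Model n) : Prop := ∀ u v, ⟪B u, v⟫_ℝ = -⟪u, B v⟫_ℝ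

/-- `B` is skew, and so is `u ↦ ⟪b, u⟫ x - ⟪x, u⟫ b`. Only the multiples of the identity survive
symmetrisation. -/
theorem quadDeriv_killing {b : Model n} {l : ℝ} {B : Model n →L[ℝ] Model n} (hB : IsSkew B)
    (x u v : Model n) : ⟪quadDeriv b l B x u, v⟫_ℝ + ⟪u, quadDeriv b l B x v⟫_ℝ =
      2 * (l + 2 * ⟪b, x⟫_ℝ) * ⟪u, v⟫_ℝ := by
  simp only [quadDeriv_apply, inner_add_left, inner_add_right, inner_sub_left, inner_sub_right,
    inner_smul_left, inner_smul_right, hB u v, real_inner_comm, RCLike.conj_to_real]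
  ring

/-- A symmetric bilinear form of which the Kulkarni–Nomizu product with the metric vanishes is
zero in dimension at least three. -/
theorem eq_zero_of_kulkarni_nomizu (hn : 2 < n) (H : Model n →L[ℝ] Model n →L[ℝ] ℝ)
    (h : ∀ s u v w, H s v * ⟪u, w⟫_ℝ - H s w * ⟪u, v⟫_ℝ = H u v * ⟪s, w⟫_ℝ - H u w * ⟪s, v⟫_ℝ) :
    H = 0 := by
  let e := EuclideanSpace.basisFun (Fin n) ℝ
  have he : ∀ i j, ⟪e i, e j⟫_ℝ = if i = j then 1 else 0 := orthonormal_iff_ite.1 e.orthonormal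
  have hex : ∀ i j : Fin n, ∃ k, k ≠ i ∧ k ≠ j := by
    intro i j
    have : ((Finset.univ : Finset (Fin n)) \ {i, j}).Nonempty := by
      rw [← Finset.card_pos]
      have h1 := Finset.le_card_sdiff ({i, j} : Finset (Fin n)) Finset.univ
      have h2 := Finset.card_le_two (a := i) (b := j)
      simp only [Finset.card_univ, Fintype.card_fin] at h1
      omega
    obtain ⟨k, hk⟩ := this
    simp only [Finset.mem_sdiff, Finset.mem_univ, true_and, Finset.mem_insert,
      Finset.mem_singleton, not_or] at hk
    exact ⟨k, hk⟩
  -- A third index `k`, tested in the second and fourth slots, isolates the entry `(i, j)`.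
  have hoff : ∀ i j, i ≠ j → H (e i) (e j) = 0 := by
    intro i j hij
    obtain ⟨k, hki, hkj⟩ := hex i j
    have := h (e i) (e k) (e j) (e k)
    simpa [he, hij, hki, hkj, hki.symm, hkj.symm] using this
  have hdiag : ∀ i k, k ≠ i → H (e i) (e i) = -H (e k) (e k) := by
    intro i k hki
    have := h (e i) (e k) (e i) (e k)
    simpa [he, hki, hki.symm] using this
  -- Diagonal entries at distinct indices are opposite to each other. Around a cycle of three
  -- indices this forces them to vanish.
  have hd : ∀ i, H (e i) (e i) = 0 := by
    intro i
    obtain ⟨j, hj, -⟩ := hex i i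
    obtain ⟨k, hki, hkj⟩ := hex i j
    have h1 := hdiag i j hj
    have h2 := hdiag i k hki
    have h3 := hdiag j k hkj
    linarith
  refine ContinuousLinearMap.coe_injective (e.toBasis.ext fun i =>
    ContinuousLinearMap.coe_injective (e.toBasis.ext fun j => ?_))
  by_cases hij : i = j
  · subst hij
    simpa using hd i
  · simpa using hoff i j hij

theorem contDiffAt_fderiv {E F : Type*} [NormedAddCommGroup E] [NormedSpace ℝ E]
    [NormedAddCommGroup F] [NormedSpace ℝ F] {f : E → F} {x : E} (h : ContDiffAt ℝ ∞ f x) :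
    ContDiffAt ℝ ∞ (fderiv ℝ f) x :=
  h.fderiv_right (by simp)

theorem fderiv_fderiv_symm {E F : Type*} [NormedAddCommGroup E] [NormedSpace ℝ E]
    [NormedAddCommGroup F] [NormedSpace ℝ F] {f : E → F} {x : E} (h : ContDiffAt ℝ ∞ f x)
    (u v : E) : fderiv ℝ (fderiv ℝ f) x u v = fderiv ℝ (fderiv ℝ f) x v u :=
  h.isSymmSndFDerivAt (by simpa using two_le_infty) u v

theorem fderiv_clm_apply_const {E F G : Type*} [NormedAddCommGroup E] [NormedSpace ℝ E]
    [NormedAddCommGroup F] [NormedSpace ℝ F] [NormedAddCommGroup G] [NormedSpace ℝ G]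
    {c : E → F →L[ℝ] G} {x : E} (h : DifferentiableAt ℝ c x) (v : F) (u : E) :
    fderiv ℝ (fun x => c x v) x u = fderiv ℝ c x u v := by
  rw [fderiv_clm_apply h (differentiableAt_const v)]
  simp

theorem fderiv_inner_const {E F : Type*} [NormedAddCommGroup E] [NormedSpace ℝ E]
    [NormedAddCommGroup F] [InnerProductSpace ℝ F] {g : E → F} {x : E}
    (h : DifferentiableAt ℝ g x) (w : F) (u : E) :
    fderiv ℝ (fun x => ⟪g x, w⟫_ℝ) x u = ⟪fderiv ℝ g x u, w⟫_ℝ := by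
  rw [fderiv_inner_apply ℝ h (differentiableAt_const w)]
  simp

/-! ### Prolongation of the flat conformal Killing equation -/

section Killing

variable {W : Set (Model n)} {y : Model n → Model n} {f : Model n → ℝ}

/-- The second derivative of a conformal Killing field in terms of its conformal factor. -/
theorem inner_fderiv_fderiv_of_killing (hW : IsOpen W) (hy : ∀ x ∈ W, ContDiffAt ℝ ∞ y x)
    (hf : ∀ x ∈ W, ContDiffAt ℝ ∞ f x)
    (h : ∀ x ∈ W, ∀ u v, ⟪fderiv ℝ y x u, v⟫_ℝ + ⟪u, fderiv ℝ y x v⟫_ℝ = 2 * f x * ⟪u, v⟫_ℝ)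
    {x : Model n} (hx : x ∈ W) (u v w : Model n) :
    ⟪fderiv ℝ (fderiv ℝ y) x u v, w⟫_ℝ =
      fderiv ℝ f x u * ⟪v, w⟫_ℝ + fderiv ℝ f x v * ⟪u, w⟫_ℝ - fderiv ℝ f x w * ⟪u, v⟫_ℝ := by
  have hA : DifferentiableAt ℝ (fderiv ℝ y) x :=
    (contDiffAt_fderiv (hy x hx)).differentiableAt (by simp)
  have hAv : ∀ v, DifferentiableAt ℝ (fun x => fderiv ℝ y x v) x := fun v =>
    hA.clm_apply (differentiableAt_const v)
  have hfd : DifferentiableAt ℝ f x := (hf x hx).differentiableAt (by simp)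
  -- The Killing equation differentiated in the direction `w`.
  have key : ∀ w u v, ⟪fderiv ℝ (fderiv ℝ y) x w u, v⟫_ℝ + ⟪fderiv ℝ (fderiv ℝ y) x w v, u⟫_ℝ =
      2 * fderiv ℝ f x w * ⟪u, v⟫_ℝ := by
    intro w u v
    have h1 : (fun x => ⟪fderiv ℝ y x u, v⟫_ℝ + ⟪fderiv ℝ y x v, u⟫_ℝ) =ᶠ[𝓝 x]
        fun x => f x * (2 * ⟪u, v⟫_ℝ) := by
      filter_upwards [hW.mem_nhds hx] with z hz
      rw [real_inner_comm u, h z hz]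
      ring
    have h2 := congrArg (fun T : Model n →L[ℝ] ℝ => T w) h1.fderiv_eq
    rw [fderiv_fun_add ((hAv u).inner ℝ (differentiableAt_const v))
      ((hAv v).inner ℝ (differentiableAt_const u)), _root_.add_apply,
      fderiv_inner_const (hAv u), fderiv_inner_const (hAv v), fderiv_clm_apply_const hA,
      fderiv_clm_apply_const hA, fderiv_mul_const hfd] at h2
    rw [h2, _root_.smul_apply, smul_eq_mul]
    ring
  -- As for Christoffel symbols: in `k1 + k2 - k3` the symmetry of the second derivative cancels all
  -- terms but one.
  have hs := fderiv_fderiv_symm (hy x hx)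
  have k1 := key u v w
  have k2 := key v u w
  have k3 := key w u v
  rw [hs v u] at k2
  rw [hs w u, hs w v] at k3
  linarith [real_inner_comm u v]

/-- The conformal factor of a conformal Killing field is affine in dimension at least three. -/
theorem fderiv_fderiv_eq_zero_of_killing (hn : 2 < n) (hW : IsOpen W)
    (hy : ∀ x ∈ W, ContDiffAt ℝ ∞ y x) (hf : ∀ x ∈ W, ContDiffAt ℝ ∞ f x)
    (h : ∀ x ∈ W, ∀ u v, ⟪fderiv ℝ y x u, v⟫_ℝ + ⟪u, fderiv ℝ y x v⟫_ℝ = 2 * f x * ⟪u, v⟫_ℝ)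
    {x : Model n} (hx : x ∈ W) : fderiv ℝ (fderiv ℝ f) x = 0 := by
  refine eq_zero_of_kulkarni_nomizu hn _ fun s u v w => ?_
  have hA := fun z hz => contDiffAt_fderiv (hy z hz)
  have hdf : DifferentiableAt ℝ (fderiv ℝ f) x :=
    (contDiffAt_fderiv (hf x hx)).differentiableAt (by simp)
  have hdfv : ∀ v, DifferentiableAt ℝ (fun z => fderiv ℝ f z v) x := fun v =>
    hdf.clm_apply (differentiableAt_const v)
  have hAv : ∀ v, ∀ z ∈ W, ContDiffAt ℝ ∞ (fun z => fderiv ℝ y z v) z := fun v z hz =>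
    (hA z hz).clm_apply contDiffAt_const
  -- One more derivative: the third derivative of `y` in terms of the Hessian of `f`.
  have key : ∀ s u v w, ⟪fderiv ℝ (fderiv ℝ fun z => fderiv ℝ y z v) x s u, w⟫_ℝ =
      fderiv ℝ (fderiv ℝ f) x s u * ⟪v, w⟫_ℝ + fderiv ℝ (fderiv ℝ f) x s v * ⟪u, w⟫_ℝ
        - fderiv ℝ (fderiv ℝ f) x s w * ⟪u, v⟫_ℝ := by
    intro s u v w
    have hD : DifferentiableAt ℝ (fderiv ℝ fun z => fderiv ℝ y z v) x :=
      (contDiffAt_fderiv (hAv v x hx)).differentiableAt (by simp)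
    have h1 : (fun z => ⟪fderiv ℝ (fun z => fderiv ℝ y z v) z u, w⟫_ℝ) =ᶠ[𝓝 x]
        fun z => fderiv ℝ f z u * ⟪v, w⟫_ℝ + fderiv ℝ f z v * ⟪u, w⟫_ℝ
          - fderiv ℝ f z w * ⟪u, v⟫_ℝ := by
      filter_upwards [hW.mem_nhds hx] with z hz
      rw [fderiv_clm_apply_const ((hA z hz).differentiableAt (by simp))]
      exact inner_fderiv_fderiv_of_killing hW hy hf h hz u v w
    have h2 := congrArg (fun T : Model n →L[ℝ] ℝ => T s) h1.fderiv_eq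
    rw [fderiv_inner_const (hD.clm_apply (differentiableAt_const u)),
      fderiv_clm_apply_const hD, fderiv_fun_sub (((hdfv u).mul_const _).fun_add ((hdfv v).mul_const _))
        ((hdfv w).mul_const _), fderiv_fun_add ((hdfv u).mul_const _) ((hdfv v).mul_const _),
      fderiv_mul_const (hdfv u), fderiv_mul_const (hdfv v), fderiv_mul_const (hdfv w)] at h2
    simp only [_root_.sub_apply, _root_.add_apply,
      _root_.smul_apply, smul_eq_mul, fderiv_clm_apply_const hdf] at h2
    rw [h2]
    ring
  -- Third derivatives are symmetric in `s` and `u`. Equating the two expressions gives the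
  -- Kulkarni–Nomizu identity for the Hessian.
  have k1 := key s u v w
  have k2 := key u s v w
  rw [fderiv_fderiv_symm (hAv v x hx) u s, fderiv_fderiv_symm (hf x hx) u s] at k2
  linarith

/-- The infinitesimal Liouville theorem: conformal Killing fields of flat space are quadratic. -/
theorem exists_eqOn_quadField_of_killing (hn : 2 < n) (hW : IsOpen W) (hc : IsPreconnected W)
    (hy : ∀ x ∈ W, ContDiffAt ℝ ∞ y x)
    (h : ∀ x ∈ W, ∀ u v, ⟪fderiv ℝ y x u, v⟫_ℝ + ⟪u, fderiv ℝ y x v⟫_ℝ = 2 * f x * ⟪u, v⟫_ℝ) :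
    ∃ a b l B, IsSkew B ∧ EqOn y (quadField a b l B) W := by
  rcases W.eq_empty_or_nonempty with rfl | ⟨x₀, hx₀⟩
  · exact ⟨0, 0, 0, 0, fun u v => by simp, eqOn_empty _ _⟩
  -- No regularity of `f` is given. Testing the equation on a unit vector identifies `f` on `W` with
  -- the smooth function `F`.
  let e : Model n := EuclideanSpace.single ⟨0, by omega⟩ 1
  have he : ⟪e, e⟫_ℝ = 1 := by simp [e]
  let F : Model n → ℝ := fun x => ⟪fderiv ℝ y x e, e⟫_ℝ
  have hF : ∀ x ∈ W, ContDiffAt ℝ ∞ F x := fun x hx =>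
    ((contDiffAt_fderiv (hy x hx)).clm_apply contDiffAt_const).inner ℝ contDiffAt_const
  have hk : ∀ x ∈ W, ∀ u v,
      ⟪fderiv ℝ y x u, v⟫_ℝ + ⟪u, fderiv ℝ y x v⟫_ℝ = 2 * F x * ⟪u, v⟫_ℝ := by
    intro x hx u v
    have h1 := h x hx e e
    rw [he, real_inner_comm (fderiv ℝ y x e), mul_one] at h1
    rw [h x hx]
    have h2 : f x = F x := by simp only [F]; linarith
    rw [h2]
  obtain ⟨β, hβ⟩ := hW.exists_is_const_of_fderiv_eq_zero hc
    (fun x hx => ((contDiffAt_fderiv (hF x hx)).differentiableAt (by simp)).differentiableWithinAt)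
    (fun x hx => fderiv_fderiv_eq_zero_of_killing hn hW hy hF hk hx)
  -- The factor of a quadratic field is `l + 2 ⟪b, x⟫`, so `b` must be half the constant gradient of
  -- `F`.
  let b : Model n := (1 / 2 : ℝ) • (InnerProductSpace.toDual ℝ (Model n)).symm β
  have hb : ∀ x ∈ W, ∀ u, fderiv ℝ F x u = 2 * ⟪b, u⟫_ℝ := by
    intro x hx u
    rw [hβ x hx]
    simp [b, inner_smul_left]
  -- Once the part coming from `b` is removed, the derivative of `y` is constant. Its value `C` has
  -- symmetric part `l` times the identity and skew part `B`.
  let C : Model n →L[ℝ] Model n := fderiv ℝ y x₀ - quadDeriv b 0 0 x₀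
  have hC : ∀ x ∈ W, ∀ v, fderiv ℝ y x v = C v + quadDeriv b 0 0 x v := by
    intro x hx v
    have hA : ∀ z ∈ W, DifferentiableAt ℝ (fun z => fderiv ℝ y z v) z := fun z hz =>
      ((contDiffAt_fderiv (hy z hz)).differentiableAt (by simp)).clm_apply
        (differentiableAt_const v)
    have hq : ∀ z, HasFDerivAt (fun z => quadDeriv b 0 0 z v)
        (((2 : ℝ) • innerSL ℝ b).smulRight v + (2 * ⟪b, v⟫_ℝ) • ContinuousLinearMap.id ℝ (Model n)
          - ((2 : ℝ) • innerSL ℝ v).smulRight b) z := by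
      intro z
      let T := ((2 : ℝ) • innerSL ℝ b).smulRight v
          + (2 * ⟪b, v⟫_ℝ) • ContinuousLinearMap.id ℝ (Model n)
          - ((2 : ℝ) • innerSL ℝ v).smulRight b
      have : (fun z => quadDeriv b 0 0 z v) = T := by
        ext1 z
        simp [T, quadDeriv_apply, real_inner_comm v z]
      rw [this]
      exact T.hasFDerivAt
    have h1 := hW.eqOn_of_fderiv_eq hc (f := fun z => fderiv ℝ y z v)
      (g := fun z => quadDeriv b 0 0 z v + C v)
      (fun z hz => (hA z hz).differentiableWithinAt)
      (fun z _ => ((hq z).differentiableAt.add_const (C v)).differentiableWithinAt)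
      (fun z hz => ?_) hx₀ (by simp [C]) hx
    · rw [add_comm]
      exact h1
    · ext1 u
      rw [fderiv_clm_apply_const ((contDiffAt_fderiv (hy z hz)).differentiableAt (by simp)),
        ((hq z).add_const (C v)).fderiv]
      refine ext_inner_right ℝ fun w => ?_
      rw [inner_fderiv_fderiv_of_killing hW hy hF hk hz, hb z hz, hb z hz, hb z hz]
      simp [inner_add_left, inner_sub_left, inner_smul_left, real_inner_comm u v]
      ring
  let l : ℝ := F x₀ - 2 * ⟪b, x₀⟫_ℝ
  have hCk : ∀ u v, ⟪C u, v⟫_ℝ + ⟪u, C v⟫_ℝ = 2 * l * ⟪u, v⟫_ℝ := by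
    intro u v
    have h1 := hk x₀ hx₀ u v
    have h2 := quadDeriv_killing (b := b) (l := 0) (B := 0) (fun u v => by simp) x₀ u v
    rw [hC x₀ hx₀, hC x₀ hx₀, inner_add_left, inner_add_right] at h1
    simp only [l]
    linarith
  let B : Model n →L[ℝ] Model n := C - l • ContinuousLinearMap.id ℝ (Model n)
  let a : Model n := y x₀ - quadField 0 b l B x₀
  refine ⟨a, b, l, B, fun u v => ?_, ?_⟩
  · have := hCk u v
    simp [B, inner_sub_left, inner_sub_right, inner_smul_left, inner_smul_right]
    linarith
  · refine hW.eqOn_of_fderiv_eq hc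
      (fun z hz => ((hy z hz).differentiableAt (by simp)).differentiableWithinAt)
      (fun z _ => (hasFDerivAt_quadField a b l B z).differentiableAt.differentiableWithinAt)
      (fun z hz => ?_) hx₀ ?_
    · ext1 v
      rw [hC z hz, (hasFDerivAt_quadField a b l B z).fderiv]
      simp [quadDeriv_apply, B]
      abel
    · simp only [a, quadField]
      abel

end Killing

end

/-! ### The flat metric and stereographic projection -/

section

variable {n : ℕ}

/-- The flat metric. -/
def flatMetric (n : ℕ) : RiemMetric n (Model n) where
  inner := (riemannianMetricVectorSpace (Model n)).inner
  symm := (riemannianMetricVectorSpace (Model n)).symm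
  pos := (riemannianMetricVectorSpace (Model n)).pos
  isVonNBounded := (riemannianMetricVectorSpace (Model n)).isVonNBounded
  contMDiff := (riemannianMetricVectorSpace (Model n)).contMDiff.of_le le_top

theorem metricAt_flatMetric (x u v : Model n) : metricAt (flatMetric n) x u v = ⟪u, v⟫_ℝ := rfl

/-- The derivatives of `X` and `Z` arising from `⟪X, Z⟫` cancel those in the brackets. What remains
is tensorial, so constant test fields suffice in the Killing equation. -/
theorem lieDerivAt_flatMetric {Y X Z : Model n → Model n} {x : Model n}
    (hX : DifferentiableAt ℝ X x) (hZ : DifferentiableAt ℝ Z x) :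
    lieDerivAt (flatMetric n) Y X Z x =
      ⟪fderiv ℝ Y x (X x), Z x⟫_ℝ + ⟪X x, fderiv ℝ Y x (Z x)⟫_ℝ := by
  simp only [lieDerivAt, metricAt_flatMetric, bracketAt_model, dirAt_model,
    fderiv_inner_apply ℝ hX hZ, inner_sub_left, inner_sub_right]
  ring

theorem isCKVFOn_flatMetric {Y : Model n → Model n} {V : Set (Model n)} (hV : IsOpen V) :
    IsCKVFOn (flatMetric n) Y V ↔ (∀ x ∈ V, ContDiffAt ℝ ∞ Y x) ∧
      ∃ f : Model n → ℝ, ∀ x ∈ V, ∀ u v,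
        ⟪fderiv ℝ Y x u, v⟫_ℝ + ⟪u, fderiv ℝ Y x v⟫_ℝ = 2 * f x * ⟪u, v⟫_ℝ := by
  rw [isCKVFOn_iff hV]
  simp only [smoothFieldAt_model]
  refine and_congr Iff.rfl (exists_congr fun f => forall₂_congr fun x hx => ⟨fun h u v => ?_,
    fun h X Z hX hZ => ?_⟩)
  · have := h (fun _ => u) (fun _ => v) contDiffAt_const contDiffAt_const
    rwa [lieDerivAt_flatMetric (differentiableAt_const u) (differentiableAt_const v)] at this
  · rw [lieDerivAt_flatMetric (hX.differentiableAt (by simp)) (hZ.differentiableAt (by simp)), h]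
    rfl

theorem isCKVFOn_quadField (a b : Model n) (l : ℝ) {B : Model n →L[ℝ] Model n} (hB : IsSkew B) :
    IsCKVFOn (flatMetric n) (quadField a b l B) univ := by
  refine (isCKVFOn_flatMetric isOpen_univ).2 ⟨fun x _ => (contDiff_quadField a b l B).contDiffAt,
    fun x => l + 2 * ⟪b, x⟫_ℝ, fun x _ u v => ?_⟩
  rw [(hasFDerivAt_quadField a b l B x).fderiv, quadDeriv_killing hB]

theorem IsCKVFOn.exists_eqOn_quadField (hn : 2 < n) {Y : Model n → Model n} {V : Set (Model n)}
    (hV : IsOpen V) (hc : IsPreconnected V) (h : IsCKVFOn (flatMetric n) Y V) :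
    ∃ a b l B, IsSkew B ∧ EqOn Y (quadField a b l B) V := by
  obtain ⟨hY, f, hf⟩ := (isCKVFOn_flatMetric hV).1 h
  exact exists_eqOn_quadField_of_killing hn hV hc hY hf

/-- The Euclidean space that contains the sphere. -/
abbrev Ambient (n : ℕ) : Type := EuclideanSpace ℝ (Fin (n + 1))

theorem fact_finrank_ambient (n : ℕ) : Fact (Module.finrank ℝ (Ambient n) = n + 1) :=
  ⟨finrank_euclideanSpace_fin⟩

attribute [local instance] fact_finrank_ambient

/-- The isometry of the orthogonal complement of `v` with the model space. -/
def perpIso (v : Sphere n) : (ℝ ∙ (v : Ambient n))ᗮ ≃ₗᵢ[ℝ] Model n :=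
  (OrthonormalBasis.fromOrthogonalSpanSingleton n (ne_zero_of_mem_unit_sphere v)).repr

/-- The isometry of the model space onto the orthogonal complement of `v`. -/
def perpEmb (v : Sphere n) : Model n →ₗᵢ[ℝ] Ambient n :=
  (ℝ ∙ (v : Ambient n))ᗮ.subtypeₗᵢ.comp (perpIso v).symm.toLinearIsometry

/-- The adjoint of `perpEmb`. -/
def perpProj (v : Sphere n) : Ambient n →L[ℝ] Model n :=
  (perpIso v).toContinuousLinearEquiv.toContinuousLinearMap.comp
    (ℝ ∙ (v : Ambient n))ᗮ.orthogonalProjectionOnto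

theorem inner_sphere_self (v : Sphere n) : ⟪(v : Ambient n), (v : Ambient n)⟫_ℝ = 1 := by
  rw [real_inner_self_eq_norm_sq, norm_eq_of_mem_sphere, one_pow]

theorem inner_perpEmb_left (v : Sphere n) (x : Model n) : ⟪perpEmb v x, (v : Ambient n)⟫_ℝ = 0 :=
  Submodule.mem_orthogonal_singleton_iff_inner_left.1 ((perpIso v).symm x).2

theorem inner_perpEmb_right (v : Sphere n) (x : Model n) :
    ⟪(v : Ambient n), perpEmb v x⟫_ℝ = 0 := by
  rw [real_inner_comm, inner_perpEmb_left]

theorem inner_perpEmb (v : Sphere n) (x y : Model n) :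
    ⟪perpEmb v x, perpEmb v y⟫_ℝ = ⟪x, y⟫_ℝ := (perpEmb v).inner_map_map x y

theorem perpEmb_perpProj (v : Sphere n) (w : Ambient n) :
    perpEmb v (perpProj v w) = w - ⟪(v : Ambient n), w⟫_ℝ • (v : Ambient n) := by
  have h : perpEmb v (perpProj v w) =
      ((ℝ ∙ (v : Ambient n))ᗮ.orthogonalProjectionOnto w : Ambient n) := by
    simp [perpEmb, perpProj]
  rw [h, Submodule.coe_orthogonalProjectionOnto_apply]
  rw [Submodule.starProjection_orthogonal', _root_.sub_apply, one_apply_eq_self,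
    Submodule.starProjection_unit_singleton ℝ (norm_eq_of_mem_sphere v)]

theorem perpProj_perpEmb (v : Sphere n) (x : Model n) : perpProj v (perpEmb v x) = x := by
  apply (perpEmb v).injective
  rw [perpEmb_perpProj, inner_perpEmb_right, zero_smul, sub_zero]

theorem perpProj_self (v : Sphere n) : perpProj v (v : Ambient n) = 0 := by
  apply (perpEmb v).injective
  rw [perpEmb_perpProj, inner_sphere_self, one_smul, sub_self, map_zero]

theorem inner_perpProj (v : Sphere n) (w : Ambient n) (x : Model n) :
    ⟪perpProj v w, x⟫_ℝ = ⟪w, perpEmb v x⟫_ℝ := by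
  rw [← inner_perpEmb v, perpEmb_perpProj, inner_sub_left, inner_smul_left, inner_perpEmb_right,
    mul_zero, sub_zero]

/-- The inverse stereographic projection from `v`, as a map to the ambient space. -/
def stereoVal (v : Sphere n) (x : Model n) : Ambient n :=
  (‖x‖ ^ 2 + 4)⁻¹ • ((4 : ℝ) • perpEmb v x + (‖x‖ ^ 2 - 4) • (v : Ambient n))

/-- The derivative of `stereoVal`. -/
theorem hasFDerivAt_stereoVal (v : Sphere n) (x : Model n) :
    ∃ T : Model n →L[ℝ] Ambient n, HasFDerivAt (stereoVal v) T x ∧ ∀ h, T h =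
      (‖x‖ ^ 2 + 4)⁻¹ • ((4 : ℝ) • perpEmb v h +
        (2 * ⟪x, h⟫_ℝ) • ((v : Ambient n) - stereoVal v x)) := by
  have hr := (hasStrictFDerivAt_norm_sq x).hasFDerivAt
  have hne : ‖x‖ ^ 2 + 4 ≠ 0 := by positivity
  have h1 := (hasFDerivAt_inv hne).comp x (hr.add_const (4 : ℝ))
  have h2 := (((perpEmb v).toContinuousLinearMap.hasFDerivAt (x := x)).const_smul (4 : ℝ)).add
    ((hr.sub_const (4 : ℝ)).smul_const (v : Ambient n))
  refine ⟨_, h1.smul h2, fun h => ?_⟩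
  simp [stereoVal]
  match_scalars <;> field_simp
  all_goals ring

theorem coe_stereographic'_symm (v : Sphere n) (x : Model n) :
    ((stereographic' n v).symm x : Ambient n) = stereoVal v x := by
  rw [stereographic'_symm_apply, stereoVal, smul_add]
  have : ‖(((perpIso v).symm x : (ℝ ∙ (v : Ambient n))ᗮ) : Ambient n)‖ = ‖x‖ := (perpEmb v).norm_map x
  simp only
  erw [this]
  rfl

/-- The inverse stereographic projection from `v`, as a diffeomorphism onto its image. -/
def stereoDiffeo (v : Sphere n) : PartialDiffeomorph (𝓡 n) (𝓡 n) (Model n) (Sphere n) ∞ where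
  toPartialEquiv := (stereographic' n v).symm.toPartialEquiv
  open_source := (stereographic' n v).open_target
  open_target := (stereographic' n v).open_source
  contMDiffOn_toFun := contMDiffOn_symm_of_mem_maximalAtlas (I := 𝓡 n)
    (IsManifold.subset_maximalAtlas ⟨v, rfl⟩)
  contMDiffOn_invFun := contMDiffOn_of_mem_maximalAtlas (I := 𝓡 n)
    (IsManifold.subset_maximalAtlas ⟨v, rfl⟩)

theorem stereoDiffeo_source (v : Sphere n) : (stereoDiffeo v).source = univ :=
  stereographic'_target v

theorem stereoDiffeo_target (v : Sphere n) : (stereoDiffeo v).target = {v}ᶜ :=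
  stereographic'_source v

theorem coe_stereoDiffeo (v : Sphere n) (x : Model n) :
    (stereoDiffeo v x : Ambient n) = stereoVal v x := coe_stereographic'_symm v x

/-- The inclusion is injective on tangent vectors, so with this chain rule differentials of
sphere-valued maps can be computed in the ambient space. -/
theorem sphereInclDeriv_diffAt {M : Type*} [TopologicalSpace M] [ChartedSpace (Model n) M]
    {φ : M → Sphere n} {x : M} (hφ : MDifferentiableAt (𝓡 n) (𝓡 n) φ x) (u : Model n) :
    sphereInclDeriv n (φ x) (diffAt n φ x u) =
      mvfderiv (𝓡 n) (fun y => (φ y : Ambient n)) x u := by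
  have h1 : MDifferentiableAt (𝓡 n) 𝓘(ℝ, Ambient n) (Subtype.val : Sphere n → Ambient n) (φ x) :=
    (contMDiff_coe_sphere (φ x)).mdifferentiableAt (n := 1) (by simp)
  have := congrArg (fun T : Model n →L[ℝ] Ambient n => T u) (mfderiv_comp x h1 hφ)
  exact this.symm

theorem sphereInclDeriv_stereoDiffeo (v : Sphere n) (x h : Model n) :
    sphereInclDeriv n (stereoDiffeo v x) (diffAt n (stereoDiffeo v) x h) =
      (‖x‖ ^ 2 + 4)⁻¹ • ((4 : ℝ) • perpEmb v h +
        (2 * ⟪x, h⟫_ℝ) • ((v : Ambient n) - stereoVal v x)) := by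
  obtain ⟨T, hT, hT'⟩ := hasFDerivAt_stereoVal v x
  have h1 : (fun y => (stereoDiffeo v y : Ambient n)) = stereoVal v := funext (coe_stereoDiffeo v)
  rw [sphereInclDeriv_diffAt
    (mdifferentiableAt_partialDiffeo _ (by rw [stereoDiffeo_source]; trivial)), h1, ← hT', ← hT.fderiv]
  exact congrArg (fun T : Model n →L[ℝ] Ambient n => T h) (mfderiv_eq_fderiv)

theorem metricAt_roundMetric (x : Sphere n) (u v : Model n) :
    metricAt (roundMetric n) x u v = ⟪sphereInclDeriv n x u, sphereInclDeriv n x v⟫_ℝ := rfl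

theorem inner_stereoVal_self (v : Sphere n) (x : Model n) : ⟪stereoVal v x, stereoVal v x⟫_ℝ = 1 := by
  rw [← coe_stereoDiffeo, inner_sphere_self]

theorem inner_stereoVal_perpEmb (v : Sphere n) (x h : Model n) :
    ⟪stereoVal v x, perpEmb v h⟫_ℝ = (‖x‖ ^ 2 + 4)⁻¹ * (4 * ⟪x, h⟫_ℝ) := by
  simp [stereoVal, inner_add_left, inner_smul_left, inner_perpEmb_right]

theorem inner_stereoVal_pole (v : Sphere n) (x : Model n) :
    ⟪stereoVal v x, (v : Ambient n)⟫_ℝ = (‖x‖ ^ 2 + 4)⁻¹ * (‖x‖ ^ 2 - 4) := by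
  simp [stereoVal, inner_add_left, inner_smul_left, inner_perpEmb_left]

/-- The inverse stereographic projection from `v`, as a conformal map. -/
def stereo (v : Sphere n) : ConfLoc (flatMetric n) (roundMetric n) where
  toDiffeo := stereoDiffeo v
  isConformal := by
    -- In this normalisation the origin goes to `-v` and the projection is isometric there, so the
    -- factor equals `1` at `0`.
    refine isConformalOn_iff.2 ⟨fun x => 4 * (‖x‖ ^ 2 + 4)⁻¹, ?_, fun x _ =>
      ⟨by positivity, fun h k => ?_⟩⟩
    · refine (contMDiff_iff_contDiff.2 ?_).contMDiffOn
      exact contDiff_const.mul (((contDiff_id.norm_sq ℝ).add contDiff_const).inv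
        fun x => by positivity)
    · rw [metricAt_roundMetric, sphereInclDeriv_stereoDiffeo, sphereInclDeriv_stereoDiffeo,
        metricAt_flatMetric]
      have h1 := inner_stereoVal_self v x
      have h2 := inner_stereoVal_perpEmb v x
      have h3 := inner_stereoVal_pole v x
      have h2' := fun h => (real_inner_comm _ _).trans (h2 h)
      have h3' := (real_inner_comm _ _).trans h3
      have hne : ‖x‖ ^ 2 + 4 ≠ 0 := by positivity
      simp only [inner_smul_left, inner_smul_right, inner_add_left, inner_add_right,
        inner_sub_left, inner_sub_right, h1, h2, h3, h2', h3', inner_perpEmb, inner_perpEmb_left,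
        inner_perpEmb_right, inner_sphere_self, RCLike.conj_to_real]
      field_simp
      ring

end

/-! ### Conformal Killing fields of the sphere: extension and uniqueness -/

section

variable {n : ℕ}
  {M : Type*} [TopologicalSpace M] [ChartedSpace (Model n) M] [IsManifold (𝓡 n) ∞ M]
  {γ : RiemMetric n M}

attribute [local instance] fact_finrank_ambient

/-- The factor is an arbitrary function, so local factors glue by taking each one at its own base
point. -/
theorem isCKVFOn_univ_of_local {Y : M → Model n}
    (h : ∀ x, ∃ U, IsOpen U ∧ x ∈ U ∧ IsCKVFOn γ Y U) : IsCKVFOn γ Y univ := by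
  choose U hU hxU hY using h
  have h' := fun x => (isCKVFOn_iff (hU x)).1 (hY x)
  choose hs f hf using h'
  exact (isCKVFOn_iff isOpen_univ).2 ⟨fun x _ => hs x x (hxU x),
    fun x => f x x, fun x _ => hf x x (hxU x)⟩

theorem IsCKVFOn.mono {Y : M → Model n} {U V : Set M} (h : IsCKVFOn γ Y V) (hUV : U ⊆ V) :
    IsCKVFOn γ Y U := by
  obtain ⟨hs, f, hf⟩ := h
  exact ⟨hs.mono hUV, f, fun x hx => hf x (hUV hx)⟩

/-- The vector field of the sphere that is the projection of an infinitesimal Lorentz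
transformation, as a map to the ambient space. -/
def lorentzField (A : Ambient n →L[ℝ] Ambient n) (c : Ambient n) (y : Ambient n) : Ambient n :=
  A y + c - ⟪c, y⟫_ℝ • y

/-- On the unit sphere the term `⟪c, y⟫ y` removes the radial part of `c`, and `A y` has none. The
vector is therefore orthogonal to `y`, that is, tangent. -/
theorem exists_sphereInclDeriv_eq {A : Ambient n →L[ℝ] Ambient n} (hA : ∀ w, ⟪A w, w⟫_ℝ = 0)
    (c : Ambient n) (y : Sphere n) :
    ∃ u : Model n, sphereInclDeriv n y u = lorentzField A c y := by
  have h : lorentzField A c y ∈ (ℝ ∙ (y : Ambient n))ᗮ := by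
    rw [Submodule.mem_orthogonal_singleton_iff_inner_left, lorentzField, inner_sub_left,
      inner_add_left, hA, inner_smul_left, inner_sphere_self]
    simp
  rw [← range_mvfderiv_subtypeVal (n := n)] at h
  exact h

theorem stereo_source (v : Sphere n) : (stereo v).toDiffeo.source = univ := stereoDiffeo_source v

theorem stereo_target (v : Sphere n) : (stereo v).toDiffeo.target = {v}ᶜ := stereoDiffeo_target v

theorem coe_stereo (v : Sphere n) (x : Model n) :
    ((stereo v).toDiffeo x : Ambient n) = stereoVal v x := coe_stereoDiffeo v x

theorem mem_stereo_source (v : Sphere n) (x : Model n) : x ∈ (stereo v).toDiffeo.source := by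
  rw [stereo_source]
  trivial

theorem image_stereo (v : Sphere n) : (stereo v).toDiffeo '' univ = {v}ᶜ := by
  rw [← stereo_source v, ← stereo_target]
  exact (stereo v).toDiffeo.image_source_eq_target

/-- The dictionary between Lorentz data `(A, c)` and quadratic data `(a, b, l, B)`: `A` and `c` are
split along `v` and its orthogonal complement. The left side is the differential of inverse
stereographic projection applied to the quadratic field. -/
theorem lorentzField_stereoVal (v : Sphere n) {A : Ambient n →L[ℝ] Ambient n}
    (hA : ∀ w, ⟪A w, w⟫_ℝ = 0) (c : Ambient n) {a b : Model n} {l : ℝ} {B : Model n →L[ℝ] Model n}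
    (ha : a = perpProj v c - perpProj v (A v))
    (hb : b = -(1 / 4 : ℝ) • (perpProj v c + perpProj v (A v)))
    (hl : l = ⟪c, (v : Ambient n)⟫_ℝ) (hB : ∀ x, B x = perpProj v (A (perpEmb v x)))
    (x : Model n) :
    (‖x‖ ^ 2 + 4)⁻¹ • ((4 : ℝ) • perpEmb v (quadField a b l B x) +
        (2 * ⟪x, quadField a b l B x⟫_ℝ) • ((v : Ambient n) - stereoVal v x)) =
      lorentzField A c (stereoVal v x) := by
  have hskew : ∀ u w, ⟪A u, w⟫_ℝ = -⟪A w, u⟫_ℝ := by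
    intro u w
    have := hA (u + w)
    rw [map_add, inner_add_left, inner_add_right, inner_add_right, hA, hA] at this
    linarith
  set d := perpProj v (A v) with hd
  set e := perpProj v c with he
  have hAv : A v = perpEmb v d := by
    rw [hd, perpEmb_perpProj, real_inner_comm, hA, zero_smul, sub_zero]
  have hc : c = perpEmb v e + l • (v : Ambient n) := by
    rw [he, perpEmb_perpProj, hl, real_inner_comm]
    abel
  have hAx : A (perpEmb v x) = perpEmb v (B x) - ⟪d, x⟫_ℝ • (v : Ambient n) := by
    rw [hB, perpEmb_perpProj, real_inner_comm, hskew, hd, inner_perpProj, neg_smul]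
    abel
  have hBx : ⟪x, B x⟫_ℝ = 0 := by
    rw [hB, real_inner_comm, inner_perpProj, hA]
  have hcs : ⟪c, stereoVal v x⟫_ℝ = (‖x‖ ^ 2 + 4)⁻¹ * (4 * ⟪e, x⟫_ℝ + (‖x‖ ^ 2 - 4) * l) := by
    rw [hc, inner_add_left, real_inner_comm, inner_stereoVal_perpEmb, inner_smul_left,
      real_inner_comm _ (v : Ambient n), inner_stereoVal_pole, real_inner_comm e x]
    simp only [RCLike.conj_to_real]
    ring
  have hxq : ⟪x, quadField a b l B x⟫_ℝ = ⟪e, x⟫_ℝ - ⟪d, x⟫_ℝ + l * ‖x‖ ^ 2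
      - (1 / 4) * (⟪e, x⟫_ℝ + ⟪d, x⟫_ℝ) * ‖x‖ ^ 2 := by
    simp only [quadField, ha, hb, inner_add_right, inner_sub_right, inner_smul_right, hBx,
      real_inner_self_eq_norm_sq, real_inner_comm x]
    ring
  have hJq : perpEmb v (quadField a b l B x) = perpEmb v e - perpEmb v d + perpEmb v (B x) +
      l • perpEmb v x - ((1 / 2) * (⟪e, x⟫_ℝ + ⟪d, x⟫_ℝ)) • perpEmb v x
      + ((1 / 4) * ‖x‖ ^ 2) • (perpEmb v e + perpEmb v d) := by
    simp only [quadField, ha, hb, map_add, map_sub, map_smul, inner_add_left, inner_smul_left,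
      RCLike.conj_to_real]
    module
  have hne : ‖x‖ ^ 2 + 4 ≠ 0 := by positivity
  rw [lorentzField, hcs, hxq, hJq, stereoVal]
  simp only [map_smul, map_add, hAv, hAx]
  rw [hc]
  match_scalars <;> field_simp <;> ring

theorem IsSkew.inner_self {B : Model n →L[ℝ] Model n} (hB : IsSkew B) (x : Model n) :
    ⟪B x, x⟫_ℝ = 0 := by
  have := hB x x
  rw [real_inner_comm (B x) x] at this
  linarith

theorem sphereInclDeriv_stereo_lorentz (v : Sphere n) {A : Ambient n →L[ℝ] Ambient n}
    (hA : ∀ w, ⟪A w, w⟫_ℝ = 0) (c : Ambient n) {a b : Model n} {l : ℝ} {B : Model n →L[ℝ] Model n}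
    (ha : a = perpProj v c - perpProj v (A v))
    (hb : b = -(1 / 4 : ℝ) • (perpProj v c + perpProj v (A v)))
    (hl : l = ⟪c, (v : Ambient n)⟫_ℝ) (hB : ∀ x, B x = perpProj v (A (perpEmb v x)))
    {Y : Sphere n → Model n} (hY : ∀ y, sphereInclDeriv n y (Y y) = lorentzField A c y)
    (x : Model n) :
    diffAt n (stereo v).toDiffeo x (quadField a b l B x) = Y ((stereo v).toDiffeo x) := by
  apply sphereInclDeriv_injective n ((stereo v).toDiffeo x)
  refine (sphereInclDeriv_stereoDiffeo v x _).trans ?_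
  rw [lorentzField_stereoVal v hA c ha hb hl hB]
  refine Eq.trans ?_ (hY ((stereo v).toDiffeo x)).symm
  rw [coe_stereo]

/-- Around each `y`, the stereographic chart with pole `-y` shows the field as a quadratic field of
flat space. -/
theorem isCKVFOn_lorentz {A : Ambient n →L[ℝ] Ambient n} (hA : ∀ w, ⟪A w, w⟫_ℝ = 0)
    (c : Ambient n) {Y : Sphere n → Model n}
    (hY : ∀ y, sphereInclDeriv n y (Y y) = lorentzField A c y) :
    IsCKVFOn (roundMetric n) Y univ := by
  refine isCKVFOn_univ_of_local fun y => ⟨{-y}ᶜ, isOpen_compl_singleton, ?_, ?_⟩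
  · simpa using ne_neg_of_mem_unit_sphere ℝ y
  · let v : Sphere n := -y
    let B : Model n →L[ℝ] Model n :=
      (perpProj v).comp (A.comp (perpEmb v).toContinuousLinearMap)
    have hskew : ∀ u w, ⟪A u, w⟫_ℝ = -⟪A w, u⟫_ℝ := by
      intro u w
      have := hA (u + w)
      rw [map_add, inner_add_left, inner_add_right, inner_add_right, hA, hA] at this
      linarith
    have hB : IsSkew B := by
      intro u w
      rw [real_inner_comm (B w) u]
      change ⟪perpProj v (A (perpEmb v u)), w⟫_ℝ = -⟪perpProj v (A (perpEmb v w)), u⟫_ℝ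
      rw [inner_perpProj, inner_perpProj, hskew]
    have := IsCKVFOn.push (stereo v) isOpen_univ (stereo_source v).ge
      (fun x _ => sphereInclDeriv_stereo_lorentz v hA c rfl rfl rfl (fun x => rfl) hY x)
      (isCKVFOn_quadField _ _ _ hB)
    rwa [image_stereo] at this

/-- The dictionary is inverted: a quadratic field comes from Lorentz data, and the Lorentz field is
also defined at the pole. -/
theorem exists_global_of_quadField (v : Sphere n) (a b : Model n) (l : ℝ)
    {B : Model n →L[ℝ] Model n} (hB : IsSkew B) : ∃ ζ : GlobalCKVF (roundMetric n),
      ∀ x, diffAt n (stereo v).toDiffeo x (quadField a b l B x) =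
        ζ.field ((stereo v).toDiffeo x) := by
  -- The solution of `e - d = a` and `-(e + d) / 4 = b`, where `e` and `d` are to be the projections
  -- of `c` and `A v`.
  let e : Model n := (1 / 2 : ℝ) • a - (2 : ℝ) • b
  let d : Model n := -(1 / 2 : ℝ) • a - (2 : ℝ) • b
  let J : Model n →L[ℝ] Ambient n := (perpEmb v).toContinuousLinearMap
  let A : Ambient n →L[ℝ] Ambient n := J.comp (B.comp (perpProj v))
    + (innerSL ℝ (v : Ambient n)).smulRight (J d) - (innerSL ℝ (J d)).smulRight (v : Ambient n)
  let c : Ambient n := J e + l • (v : Ambient n)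
  have hAw : ∀ w, A w = perpEmb v (B (perpProj v w)) + ⟪(v : Ambient n), w⟫_ℝ • perpEmb v d
      - ⟪perpEmb v d, w⟫_ℝ • (v : Ambient n) := fun w => rfl
  have hA : ∀ w, ⟪A w, w⟫_ℝ = 0 := by
    intro w
    rw [hAw, inner_sub_left, inner_add_left, real_inner_comm, ← inner_perpProj,
      real_inner_comm, hB.inner_self, inner_smul_left, inner_smul_left]
    simp only [RCLike.conj_to_real]
    ring
  have hpA : perpProj v (A v) = d := by
    rw [hAw, perpProj_self, inner_perpEmb_left, inner_sphere_self]
    simp [perpProj_perpEmb]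
  have hpc : perpProj v c = e := by
    change perpProj v (perpEmb v e + l • (v : Ambient n)) = e
    rw [map_add, map_smul, perpProj_self, perpProj_perpEmb, smul_zero, add_zero]
  choose Y hY using exists_sphereInclDeriv_eq hA c
  refine ⟨⟨Y, isCKVFOn_lorentz hA c hY⟩, fun x =>
    sphereInclDeriv_stereo_lorentz v hA c ?_ ?_ ?_ ?_ hY x⟩
  · rw [hpc, hpA]
    simp only [e, d]
    module
  · rw [hpc, hpA]
    simp only [e, d]
    module
  · change l = ⟪perpEmb v e + l • (v : Ambient n), (v : Ambient n)⟫_ℝ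
    rw [inner_add_left, inner_perpEmb_left, inner_smul_left, inner_sphere_self]
    simp
  · intro x
    rw [hAw, perpProj_perpEmb, inner_perpEmb_right, map_sub, map_add, map_smul, map_smul,
      perpProj_perpEmb, perpProj_self]
    simp

/-- A pullback is a pushforward by the inverse conformal map. -/
theorem IsCKVFOn.pull {N : Type*} [TopologicalSpace N] [ChartedSpace (Model n) N]
    [IsManifold (𝓡 n) ∞ N] {γ' : RiemMetric n N} (φ : ConfLoc γ γ') {Y : N → Model n} {U : Set N}
    (hU : IsOpen U) (h : IsCKVFOn γ' Y U) :
    IsCKVFOn γ (pullField φ.toDiffeo Y) (φ.toDiffeo.source ∩ φ.toDiffeo ⁻¹' U) := by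
  have h1 := IsCKVFOn.push φ.symm (hU.inter φ.toDiffeo.open_target) inter_subset_right
    (Y' := pullField φ.toDiffeo Y) (fun y hy => ?_) (h.mono inter_subset_left)
  · refine h1.mono fun x hx => ⟨φ.toDiffeo x, ⟨hx.2, φ.toDiffeo.map_source hx.1⟩,
      φ.toDiffeo.left_inv hx.1⟩
  · have hs : φ.toDiffeo.symm y ∈ φ.toDiffeo.source := φ.toDiffeo.map_target hy.2
    have hy' : φ.toDiffeo (φ.toDiffeo.symm y) = y := φ.toDiffeo.right_inv hy.2
    change diffAt n φ.toDiffeo.symm y (Y y) = pullField φ.toDiffeo Y (φ.toDiffeo.symm y)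
    rw [pullField, inverse_diffAt _ hs, hy']

theorem isOpen_source_inter_preimage {N : Type*} [TopologicalSpace N] [ChartedSpace (Model n) N]
    [IsManifold (𝓡 n) ∞ N] {γ' : RiemMetric n N} (φ : ConfLoc γ γ') {U : Set N}
    (hU : IsOpen U) : IsOpen (φ.toDiffeo.source ∩ φ.toDiffeo ⁻¹' U) :=
  φ.toDiffeo.toOpenPartialHomeomorph.isOpen_inter_preimage hU

/-- A global conformal Killing field of the sphere is quadratic in stereographic coordinates. -/
theorem exists_quadField_of_global (hn : 2 < n) (ζ : GlobalCKVF (roundMetric n)) (v : Sphere n) :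
    ∃ a b l B, IsSkew B ∧ ∀ x, diffAt n (stereo v).toDiffeo x (quadField a b l B x) =
        ζ.field ((stereo v).toDiffeo x) := by
  have h := ζ.isCKVF.pull (stereo v) isOpen_univ
  rw [stereo_source, preimage_univ, inter_univ] at h
  obtain ⟨a, b, l, B, hB, he⟩ := h.exists_eqOn_quadField hn isOpen_univ isPreconnected_univ
  refine ⟨a, b, l, B, hB, fun x => ?_⟩
  rw [← he (mem_univ x)]
  exact diffAt_pullField _ (mem_stereo_source v x) ζ.field

/-- Quadratic fields are polynomial, hence analytic on the connected model space, so the germ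
determines the field. -/
theorem quadField_eq_of_eventuallyEq {a b a' b' : Model n} {l l' : ℝ}
    {B B' : Model n →L[ℝ] Model n} {x : Model n}
    (h : quadField a b l B =ᶠ[𝓝 x] quadField a' b' l' B') :
    quadField a b l B = quadField a' b' l' B' := by
  have hω : ∀ (a b : Model n) l B, AnalyticOnNhd ℝ (quadField a b l B) univ := by
    intro a b l B
    rw [← contDiff_omega_iff_analyticOnNhd]
    unfold quadField
    exact (((contDiff_const.add B.contDiff).add (contDiff_id.const_smul l)).add
      ((contDiff_const.mul (contDiff_const.inner ℝ contDiff_id)).smul contDiff_id)).sub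
      ((contDiff_id.norm_sq ℝ).smul contDiff_const)
  exact (hω a b l B).eq_of_eventuallyEq (hω a' b' l' B') h

/-- Two conformal Killing fields of the sphere that agree near a point are equal. -/
theorem global_ext_of_eventuallyEq (hn : 2 < n) {ζ ζ' : GlobalCKVF (roundMetric n)} {p : Sphere n}
    (h : ∀ᶠ q in 𝓝 p, ζ.field q = ζ'.field q) : ζ = ζ' := by
  have key : ∀ q, ζ.field q = ζ'.field q := by
    intro q
    -- A pole distinct from `p` and `q` puts both in one chart. It exists because the chart that
    -- omits `p` still has two distinct points, and `q` is at most one of them.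
    have : ({p, q}ᶜ : Set (Sphere n)).Nonempty := by
      have hmem : ∀ x, (stereo p).toDiffeo x ≠ p := fun x => by
        have := (stereo p).toDiffeo.map_source (mem_stereo_source p x)
        rwa [stereo_target] at this
      have hne : (0 : Model n) ≠ EuclideanSpace.single ⟨0, by omega⟩ 1 := fun h => by
        simpa using congrFun (congrArg WithLp.ofLp h) ⟨0, by omega⟩
      by_cases hq : (stereo p).toDiffeo 0 = q
      · refine ⟨(stereo p).toDiffeo (EuclideanSpace.single ⟨0, by omega⟩ 1), ?_⟩
        rintro (h | h)
        · exact hmem _ h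
        · exact hne ((stereo p).toDiffeo.injOn (mem_stereo_source p _) (mem_stereo_source p _)
            (hq.trans h.symm))
      · refine ⟨(stereo p).toDiffeo 0, ?_⟩
        rintro (h | h)
        · exact hmem _ h
        · exact hq h
    obtain ⟨v, hv⟩ := this
    simp only [mem_compl_iff, mem_insert_iff, mem_singleton_iff, not_or] at hv
    have hp : p ∈ (stereo v).toDiffeo.target := by
      rw [stereo_target]
      exact Ne.symm hv.1
    have hq : q ∈ (stereo v).toDiffeo.target := by
      rw [stereo_target]
      exact Ne.symm hv.2
    obtain ⟨a, b, l, B, -, he⟩ := exists_quadField_of_global hn ζ v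
    obtain ⟨a', b', l', B', -, he'⟩ := exists_quadField_of_global hn ζ' v
    have hpr : (stereo v).toDiffeo ((stereo v).toDiffeo.symm p) = p :=
      (stereo v).toDiffeo.right_inv hp
    have hqr : (stereo v).toDiffeo ((stereo v).toDiffeo.symm q) = q :=
      (stereo v).toDiffeo.right_inv hq
    have hct : Tendsto (stereo v).toDiffeo (𝓝 ((stereo v).toDiffeo.symm p)) (𝓝 p) := by
      have := (contMDiffAt_partialDiffeo (stereo v).toDiffeo
        (mem_stereo_source v ((stereo v).toDiffeo.symm p))).continuousAt
      rwa [ContinuousAt, hpr] at this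
    have heq : quadField a b l B = quadField a' b' l' B' := by
      refine quadField_eq_of_eventuallyEq (x := (stereo v).toDiffeo.symm p) ?_
      filter_upwards [hct.eventually h] with x hx
      have h3 := (he x).trans (hx.trans (he' x).symm)
      have h4 := congrArg (diffAt n (stereo v).toDiffeo.symm ((stereo v).toDiffeo x)) h3
      rwa [diffAt_symm_diffAt _ (mem_stereo_source v x),
        diffAt_symm_diffAt _ (mem_stereo_source v x)] at h4
    have h5 := (he ((stereo v).toDiffeo.symm q)).symm.trans
      ((congrArg _ (congrFun heq _)).trans (he' ((stereo v).toDiffeo.symm q)))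
    rwa [hqr] at h5
  obtain ⟨Y, hY⟩ := ζ
  obtain ⟨Y', hY'⟩ := ζ'
  obtain rfl : Y = Y' := funext key
  rfl

/-- A conformal Killing field of an open set of the sphere extends locally to the whole sphere. -/
theorem exists_global_eventuallyEq (hn : 2 < n) {Y : Sphere n → Model n} {U : Set (Sphere n)}
    (hU : IsOpen U) (hY : IsCKVFOn (roundMetric n) Y U) {p : Sphere n} (hp : p ∈ U) :
    ∃ ζ : GlobalCKVF (roundMetric n), ∀ᶠ q in 𝓝 p, ζ.field q = Y q := by
  let v : Sphere n := -p
  have hpt : p ∈ (stereo v).toDiffeo.target := by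
    rw [stereo_target]
    simpa using ne_neg_of_mem_unit_sphere ℝ p
  let x₀ : Model n := (stereo v).toDiffeo.symm p
  have hx₀ : (stereo v).toDiffeo x₀ = p := (stereo v).toDiffeo.right_inv hpt
  have hO := isOpen_source_inter_preimage (stereo v) hU
  -- The flat classification needs a connected domain, hence a ball in the chart.
  obtain ⟨r, hr, hrs⟩ := Metric.isOpen_iff.1 hO x₀
    ⟨mem_stereo_source v x₀, by rw [mem_preimage, hx₀]; exact hp⟩
  obtain ⟨a, b, l, B, hB, he⟩ := ((hY.pull (stereo v) hU).mono hrs).exists_eqOn_quadField hn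
    Metric.isOpen_ball (convex_ball x₀ r).isPreconnected
  obtain ⟨ζ, hζ⟩ := exists_global_of_quadField v a b l hB
  refine ⟨ζ, ?_⟩
  have hct : ContinuousAt (stereo v).toDiffeo.symm p :=
    (contMDiffAt_partialDiffeo (stereo v).toDiffeo.symm hpt).continuousAt
  filter_upwards [hct.eventually (Metric.ball_mem_nhds x₀ hr),
    (stereo v).toDiffeo.open_target.mem_nhds hpt] with q hq hqt
  have hqr : (stereo v).toDiffeo ((stereo v).toDiffeo.symm q) = q :=
    (stereo v).toDiffeo.right_inv hqt
  have h1 := hζ ((stereo v).toDiffeo.symm q)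
  rw [← he hq, diffAt_pullField _ (mem_stereo_source v _), hqr] at h1
  exact h1.symm

end

/-! ### Conformal diffeomorphisms of the sphere from Lorentz transformations -/

section

variable {n : ℕ}

attribute [local instance] fact_finrank_ambient

/-- A linear map of `ℝⁿ⁺¹ × ℝ` that multiplies the Lorentz form by the square of `k`. -/
def IsLorentz (L : Ambient n × ℝ →ₗ[ℝ] Ambient n × ℝ) (k : ℝ) : Prop :=
  0 < k ∧ ∀ z w, ⟪(L z).1, (L w).1⟫_ℝ - (L z).2 * (L w).2 = k ^ 2 * (⟪z.1, w.1⟫_ℝ - z.2 * w.2)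

theorem IsLorentz.symm {L : (Ambient n × ℝ) ≃ₗ[ℝ] (Ambient n × ℝ)} {k : ℝ}
    (hL : IsLorentz L.toLinearMap k) : IsLorentz L.symm.toLinearMap k⁻¹ := by
  refine ⟨inv_pos.2 hL.1, fun z w => ?_⟩
  have h := hL.2 (L.symm z) (L.symm w)
  simp only [LinearEquiv.coe_coe, LinearEquiv.apply_symm_apply] at h ⊢
  have := hL.1.ne'
  rw [h]
  field_simp

/-- The action of a linear map of `ℝⁿ⁺¹ × ℝ` on the sphere of null directions. -/
def mobiusVal (L : Ambient n × ℝ →ₗ[ℝ] Ambient n × ℝ) (y : Ambient n) : Ambient n :=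
  (L (y, 1)).2⁻¹ • (L (y, 1)).1

/-- The image of the null vector `(y, 1)` is null. With zero time component its space component
would vanish too, against injectivity. -/
theorem IsLorentz.snd_ne_zero {L : (Ambient n × ℝ) ≃ₗ[ℝ] (Ambient n × ℝ)} {k : ℝ}
    (hL : IsLorentz L.toLinearMap k) (y : Sphere n) : (L ((y : Ambient n), 1)).2 ≠ 0 := by
  intro h
  have h1 := hL.2 ((y : Ambient n), 1) ((y : Ambient n), 1)
  simp only [LinearEquiv.coe_coe, h, inner_sphere_self, mul_zero, sub_zero, mul_one, sub_self,
    inner_self_eq_zero] at h1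
  have h2 : L ((y : Ambient n), 1) = 0 := Prod.ext h1 h
  have h3 := congrArg Prod.snd (L.map_eq_zero_iff.1 h2)
  exact one_ne_zero h3

theorem IsLorentz.inner_fst {L : (Ambient n × ℝ) ≃ₗ[ℝ] (Ambient n × ℝ)} {k : ℝ}
    (hL : IsLorentz L.toLinearMap k) (y : Sphere n) :
    ⟪(L ((y : Ambient n), 1)).1, (L ((y : Ambient n), 1)).1⟫_ℝ = (L ((y : Ambient n), 1)).2 ^ 2 := by
  have h1 := hL.2 ((y : Ambient n), 1) ((y : Ambient n), 1)
  simp only [LinearEquiv.coe_coe, inner_sphere_self, mul_one, sub_self, mul_zero] at h1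
  linarith

theorem IsLorentz.mobiusVal_mem {L : (Ambient n × ℝ) ≃ₗ[ℝ] (Ambient n × ℝ)} {k : ℝ}
    (hL : IsLorentz L.toLinearMap k) (y : Sphere n) :
    mobiusVal L.toLinearMap y ∈ Metric.sphere (0 : Ambient n) 1 := by
  have h : ⟪mobiusVal L.toLinearMap (y : Ambient n), mobiusVal L.toLinearMap (y : Ambient n)⟫_ℝ
      = 1 := by
    have := hL.snd_ne_zero y
    rw [mobiusVal, inner_smul_left, inner_smul_right, LinearEquiv.coe_coe, hL.inner_fst,
      RCLike.conj_to_real]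
    field_simp
  rw [mem_sphere_zero_iff_norm]
  rw [real_inner_self_eq_norm_sq] at h
  nlinarith [norm_nonneg (mobiusVal L.toLinearMap (y : Ambient n))]

/-- Rescaling makes `(mobiusVal L y, 1)` a multiple of `L (y, 1)`, and the action on directions
ignores nonzero multiples. -/
theorem IsLorentz.mobiusVal_symm {L : (Ambient n × ℝ) ≃ₗ[ℝ] (Ambient n × ℝ)} {k : ℝ}
    (hL : IsLorentz L.toLinearMap k) (y : Sphere n) :
    mobiusVal L.symm.toLinearMap (mobiusVal L.toLinearMap (y : Ambient n)) = y := by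
  have h0 := hL.snd_ne_zero y
  have h : (mobiusVal L.toLinearMap (y : Ambient n), (1 : ℝ)) =
      (L ((y : Ambient n), 1)).2⁻¹ • L ((y : Ambient n), 1) := by
    refine Prod.ext rfl ?_
    simp [h0]
  rw [mobiusVal, h]
  simp [smul_smul, h0]

theorem hasFDerivAt_mobiusVal (L : Ambient n × ℝ →ₗ[ℝ] Ambient n × ℝ) {y : Ambient n}
    (hy : (L (y, 1)).2 ≠ 0) : ∃ T : Ambient n →L[ℝ] Ambient n,
      HasFDerivAt (mobiusVal L) T y ∧ ∀ h, T h = (L (y, 1)).2⁻¹ • ((L (h, 0)).1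
        - ((L (h, 0)).2 * (L (y, 1)).2⁻¹) • (L (y, 1)).1) := by
  have h0 : HasFDerivAt (fun y : Ambient n => L (y, 1))
      ((LinearMap.toContinuousLinearMap L).comp (ContinuousLinearMap.inl ℝ (Ambient n) ℝ)) y :=
    (LinearMap.toContinuousLinearMap L).hasFDerivAt.comp y
      ((hasFDerivAt_id y).prodMk (hasFDerivAt_const (1 : ℝ) y))
  have h1 := (hasFDerivAt_inv hy).comp y h0.snd
  refine ⟨_, h1.smul h0.fst, fun h => ?_⟩
  simp
  module

theorem contDiffAt_mobiusVal (L : Ambient n × ℝ →ₗ[ℝ] Ambient n × ℝ) {y : Ambient n}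
    (hy : (L (y, 1)).2 ≠ 0) : ContDiffAt ℝ ∞ (mobiusVal L) y := by
  have h0 : ContDiff ℝ ∞ (fun y : Ambient n => L (y, 1)) :=
    (LinearMap.toContinuousLinearMap L).contDiff.comp (contDiff_id.prodMk contDiff_const)
  exact (h0.snd.contDiffAt.inv hy).smul h0.fst.contDiffAt

/-- The map of the sphere defined by a Lorentz transformation. -/
def mobius {L : (Ambient n × ℝ) ≃ₗ[ℝ] (Ambient n × ℝ)} {k : ℝ}
    (hL : IsLorentz L.toLinearMap k) (y : Sphere n) : Sphere n :=
  ⟨mobiusVal L.toLinearMap y, hL.mobiusVal_mem y⟩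

theorem contMDiff_mobius {L : (Ambient n × ℝ) ≃ₗ[ℝ] (Ambient n × ℝ)} {k : ℝ}
    (hL : IsLorentz L.toLinearMap k) : ContMDiff (𝓡 n) (𝓡 n) ∞ (mobius hL) := by
  have h : ContMDiff (𝓡 n) 𝓘(ℝ, Ambient n) ∞
      (fun y : Sphere n => mobiusVal L.toLinearMap (y : Ambient n)) := fun y =>
    (contDiffAt_mobiusVal _ (hL.snd_ne_zero y)).contMDiffAt.comp y (contMDiff_coe_sphere y)
  exact h.codRestrict_sphere hL.mobiusVal_mem

theorem sphereInclDeriv_mobius {L : (Ambient n × ℝ) ≃ₗ[ℝ] (Ambient n × ℝ)} {k : ℝ}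
    (hL : IsLorentz L.toLinearMap k) (y : Sphere n) (u : Model n) :
    sphereInclDeriv n (mobius hL y) (diffAt n (mobius hL) y u) =
      (L ((y : Ambient n), 1)).2⁻¹ • ((L (sphereInclDeriv n y u, 0)).1
        - ((L (sphereInclDeriv n y u, 0)).2 * (L ((y : Ambient n), 1)).2⁻¹) •
          (L ((y : Ambient n), 1)).1) := by
  obtain ⟨T, hT, hT'⟩ := hasFDerivAt_mobiusVal L.toLinearMap (hL.snd_ne_zero y)
  rw [sphereInclDeriv_diffAt ((contMDiff_mobius hL y).mdifferentiableAt (by simp))]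
  refine Eq.trans ?_ (hT' _)
  have h1 : MDifferentiableAt (𝓡 n) 𝓘(ℝ, Ambient n) (Subtype.val : Sphere n → Ambient n) y :=
    (contMDiff_coe_sphere y).mdifferentiableAt (n := 1) (by simp)
  have h2 := mfderiv_comp y hT.differentiableAt.mdifferentiableAt h1
  rw [mfderiv_eq_fderiv, hT.fderiv] at h2
  exact congrArg (fun T : Model n →L[ℝ] Ambient n => T u) h2

theorem inner_sphereInclDeriv (y : Sphere n) (u : Model n) :
    ⟪(y : Ambient n), sphereInclDeriv n y u⟫_ℝ = 0 := by
  have h : sphereInclDeriv n y u ∈ (ℝ ∙ (y : Ambient n))ᗮ := by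
    rw [← range_mvfderiv_subtypeVal (n := n)]
    exact ⟨u, rfl⟩
  exact Submodule.mem_orthogonal_singleton_iff_inner_right.1 h

theorem isConformalOn_mobius {L : (Ambient n × ℝ) ≃ₗ[ℝ] (Ambient n × ℝ)} {k : ℝ}
    (hL : IsLorentz L.toLinearMap k) :
    IsConformalOn (roundMetric n) (roundMetric n) (mobius hL) univ := by
  -- The absolute value is needed because `L` may reverse time.
  refine isConformalOn_iff.2 ⟨fun y => k * |(L ((y : Ambient n), 1)).2|⁻¹, ?_, fun y _ =>
    ⟨mul_pos hL.1 (inv_pos.2 (abs_pos.2 (hL.snd_ne_zero y))), fun u v => ?_⟩⟩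
  · have h0 : ContDiff ℝ ∞ (fun y : Ambient n => (L (y, 1)).2) :=
      contDiff_snd.comp ((LinearMap.toContinuousLinearMap L.toLinearMap).contDiff.comp
        (contDiff_id.prodMk contDiff_const))
    intro y _
    have h1 : ContDiffAt ℝ ∞ (fun y : Ambient n => k * |(L (y, 1)).2|⁻¹) (y : Ambient n) :=
      contDiffAt_const.mul ((h0.contDiffAt.abs (hL.snd_ne_zero y)).inv
        (abs_ne_zero.2 (hL.snd_ne_zero y)))
    exact (h1.contMDiffAt.comp y (contMDiff_coe_sphere y)).contMDiffWithinAt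
  · rw [metricAt_roundMetric, metricAt_roundMetric, sphereInclDeriv_mobius, sphereInclDeriv_mobius]
    -- The image of a tangent vector `w` is, up to scale, `L (w, 0)` corrected by a multiple of `L
    -- (y, 1)` to have no time component. Since `L (y, 1)` is null and Lorentz-orthogonal to `L (w,
    -- 0)`, the correction does not change the products.
    have h1 := hL.2 ((y : Ambient n), 1) (sphereInclDeriv n y u, 0)
    have h2 := hL.2 ((y : Ambient n), 1) (sphereInclDeriv n y v, 0)
    have h3 := hL.2 (sphereInclDeriv n y u, 0) (sphereInclDeriv n y v, 0)
    have h4 := hL.inner_fst y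
    have h5 := hL.snd_ne_zero y
    simp only [LinearEquiv.coe_coe, inner_sphereInclDeriv, mul_zero, sub_zero] at h1 h2 h3
    simp only [inner_smul_left, inner_smul_right, inner_sub_left, inner_sub_right,
      RCLike.conj_to_real, h4, mul_pow, inv_pow, sq_abs]
    have h1' := (real_inner_comm _ _).trans (sub_eq_zero.1 h1)
    rw [sub_eq_zero.1 h2, h1', eq_add_of_sub_eq h3]
    field_simp
    ring

/-- The conformal diffeomorphism of the sphere defined by a Lorentz transformation. -/
def mobiusDiffeo {L : (Ambient n × ℝ) ≃ₗ[ℝ] (Ambient n × ℝ)} {k : ℝ}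
    (hL : IsLorentz L.toLinearMap k) : Diffeomorph (𝓡 n) (𝓡 n) (Sphere n) (Sphere n) ∞ where
  toFun := mobius hL
  invFun := mobius hL.symm
  left_inv y := Subtype.ext (hL.mobiusVal_symm y)
  right_inv y := Subtype.ext (hL.symm.mobiusVal_symm y)
  contMDiff_toFun := contMDiff_mobius hL
  contMDiff_invFun := contMDiff_mobius hL.symm

end

/-! ### Null coordinates and special conformal transformations -/

section

variable {n : ℕ}

attribute [local instance] fact_finrank_ambient

/-- The Lorentz form is nondegenerate: pairing a kernel vector with its own space and time parts
kills both. -/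
theorem IsLorentz.injective {L : Ambient n × ℝ →ₗ[ℝ] Ambient n × ℝ} {k : ℝ} (hL : IsLorentz L k) :
    Function.Injective L := by
  rw [← LinearMap.ker_eq_bot, LinearMap.ker_eq_bot']
  intro z hz
  have hk : k ^ 2 ≠ 0 := pow_ne_zero 2 hL.1.ne'
  have h1 := hL.2 z (z.1, 0)
  have h2 := hL.2 z (0, z.2)
  simp only [hz, Prod.fst_zero, Prod.snd_zero, inner_zero_left, inner_zero_right, zero_mul,
    mul_zero, sub_zero, zero_sub] at h1 h2
  have h3 := (mul_eq_zero.1 h1.symm).resolve_left hk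
  have h4 := (mul_eq_zero.1 h2.symm).resolve_left hk
  rw [neg_eq_zero, mul_self_eq_zero] at h4
  exact Prod.ext (inner_self_eq_zero.1 h3) h4

/-- Lorentz space in the null coordinates of the stereographic projection from `v`. -/
def fromNull (v : Sphere n) : Model n × ℝ × ℝ →ₗ[ℝ] Ambient n × ℝ where
  toFun z := ((4 : ℝ) • perpEmb v z.1 + (z.2.1 - 4 * z.2.2) • (v : Ambient n), z.2.1 + 4 * z.2.2)
  map_add' z w := by
    refine Prod.ext ?_ ?_
    · simp only [Prod.fst_add, Prod.snd_add, map_add]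
      module
    · simp only [Prod.fst_add, Prod.snd_add]
      ring
  map_smul' c z := by
    refine Prod.ext ?_ ?_
    · simp only [Prod.smul_fst, Prod.smul_snd, map_smul, RingHom.id_apply, smul_eq_mul]
      module
    · simp only [Prod.smul_fst, Prod.smul_snd, RingHom.id_apply, smul_eq_mul]
      ring

/-- The inverse of `fromNull`. -/
def toNull (v : Sphere n) : Ambient n × ℝ →ₗ[ℝ] Model n × ℝ × ℝ where
  toFun z := ((1 / 4 : ℝ) • perpProj v z.1, (z.2 + ⟪(v : Ambient n), z.1⟫_ℝ) / 2,
    (z.2 - ⟪(v : Ambient n), z.1⟫_ℝ) / 8)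
  map_add' z w := by
    refine Prod.ext ?_ (Prod.ext ?_ ?_)
    · simp only [Prod.fst_add, map_add, smul_add]
    · simp only [Prod.fst_add, Prod.snd_add, inner_add_right]
      ring
    · simp only [Prod.fst_add, Prod.snd_add, inner_add_right]
      ring
  map_smul' c z := by
    refine Prod.ext ?_ (Prod.ext ?_ ?_)
    · simp only [Prod.smul_fst, map_smul, RingHom.id_apply]
      module
    · simp only [Prod.smul_fst, Prod.smul_snd, RingHom.id_apply, smul_eq_mul, inner_smul_right]
      ring
    · simp only [Prod.smul_fst, Prod.smul_snd, RingHom.id_apply, smul_eq_mul, inner_smul_right]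
      ring

/-- The Lorentz form in null coordinates. -/
def nullForm (z w : Model n × ℝ × ℝ) : ℝ := ⟪z.1, w.1⟫_ℝ - (z.2.1 * w.2.2 + w.2.1 * z.2.2) / 2

/-- The scale `1 / 16` cancels the `16` in `form_fromNull`, so conjugation by these maps preserves
the ratio `k`. -/
theorem nullForm_toNull (v : Sphere n) (z w : Ambient n × ℝ) :
    nullForm (toNull v z) (toNull v w) = (1 / 16) * (⟪z.1, w.1⟫_ℝ - z.2 * w.2) := by
  simp only [nullForm, toNull, LinearMap.coe_mk, AddHom.coe_mk, inner_smul_left, inner_smul_right,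
    inner_perpProj, perpEmb_perpProj, inner_sub_right, RCLike.conj_to_real]
  rw [real_inner_comm (v : Ambient n) z.1]
  ring

theorem form_fromNull (v : Sphere n) (z w : Model n × ℝ × ℝ) :
    ⟪(fromNull v z).1, (fromNull v w).1⟫_ℝ - (fromNull v z).2 * (fromNull v w).2 =
      16 * nullForm z w := by
  simp only [nullForm, fromNull, LinearMap.coe_mk, AddHom.coe_mk, inner_smul_left, inner_add_left,
    inner_add_right, inner_smul_right, inner_perpEmb, inner_perpEmb_left, inner_perpEmb_right,
    inner_sphere_self, RCLike.conj_to_real]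
  ring

/-- In null coordinates the light cone carries the paraboloid `(x, ‖x‖², 1)`, on which similarities
and special conformal maps act linearly up to scale. -/
theorem toNull_stereoVal (v : Sphere n) (x : Model n) :
    toNull v (stereoVal v x, 1) = (‖x‖ ^ 2 + 4)⁻¹ • (x, ‖x‖ ^ 2, (1 : ℝ)) := by
  have hne : ‖x‖ ^ 2 + 4 ≠ 0 := by positivity
  refine Prod.ext ?_ (Prod.ext ?_ ?_)
  · simp only [toNull, LinearMap.coe_mk, AddHom.coe_mk, stereoVal, map_smul, map_add,
      perpProj_perpEmb, perpProj_self, Prod.smul_fst]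
    module
  · simp only [toNull, LinearMap.coe_mk, AddHom.coe_mk, Prod.smul_fst, Prod.smul_snd, smul_eq_mul]
    rw [real_inner_comm, inner_stereoVal_pole]
    field_simp
    ring
  · simp only [toNull, LinearMap.coe_mk, AddHom.coe_mk, Prod.smul_snd, smul_eq_mul]
    rw [real_inner_comm, inner_stereoVal_pole]
    field_simp
    ring

theorem fromNull_null (v : Sphere n) (x : Model n) :
    fromNull v (x, ‖x‖ ^ 2, (1 : ℝ)) = (‖x‖ ^ 2 + 4) • (stereoVal v x, (1 : ℝ)) := by
  have hne : ‖x‖ ^ 2 + 4 ≠ 0 := by positivity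
  refine Prod.ext ?_ ?_
  · simp only [fromNull, LinearMap.coe_mk, AddHom.coe_mk, stereoVal, Prod.smul_fst]
    rw [smul_inv_smul₀ hne, mul_one]
  · simp [fromNull]

/-- The special conformal transformation with parameter `-b`, after the similarity `K` of ratio
`k`, in null coordinates. -/
def specialNull (b : Model n) (K : Model n →L[ℝ] Model n) (k : ℝ) :
    Model n × ℝ × ℝ →ₗ[ℝ] Model n × ℝ × ℝ where
  toFun z := (K z.1 - (k ^ 2 * z.2.1) • b, k ^ 2 * z.2.1,
    z.2.2 - 2 * ⟪b, K z.1⟫_ℝ + k ^ 2 * z.2.1 * ⟪b, b⟫_ℝ)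
  map_add' z w := by
    refine Prod.ext ?_ (Prod.ext ?_ ?_)
    · simp only [Prod.fst_add, Prod.snd_add, map_add]
      module
    · simp only [Prod.fst_add, Prod.snd_add]
      ring
    · simp only [Prod.fst_add, Prod.snd_add, map_add, inner_add_right]
      ring
  map_smul' c z := by
    refine Prod.ext ?_ (Prod.ext ?_ ?_)
    · simp only [Prod.smul_fst, Prod.smul_snd, map_smul, RingHom.id_apply, smul_eq_mul]
      module
    · simp only [Prod.smul_fst, Prod.smul_snd, RingHom.id_apply, smul_eq_mul]
      ring
    · simp only [Prod.smul_fst, Prod.smul_snd, RingHom.id_apply, smul_eq_mul, inner_smul_right,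
        map_smul]
      ring

theorem nullForm_specialNull (b : Model n) {K : Model n →L[ℝ] Model n} {k : ℝ}
    (hK : ∀ x y, ⟪K x, K y⟫_ℝ = k ^ 2 * ⟪x, y⟫_ℝ) (z w : Model n × ℝ × ℝ) :
    nullForm (specialNull b K k z) (specialNull b K k w) = k ^ 2 * nullForm z w := by
  simp only [nullForm, specialNull, LinearMap.coe_mk, AddHom.coe_mk, inner_smul_left,
    inner_sub_left, inner_sub_right, inner_smul_right, hK, RCLike.conj_to_real]
  rw [real_inner_comm b (K z.1)]
  ring

/-- A special conformal transformation after a similarity extends to the sphere. -/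
theorem exists_diffeomorph_special (v w : Sphere n) (b : Model n) {K : Model n →L[ℝ] Model n}
    {k : ℝ} (hk : 0 < k) (hK : ∀ x y, ⟪K x, K y⟫_ℝ = k ^ 2 * ⟪x, y⟫_ℝ) :
    ∃ ψ : Diffeomorph (𝓡 n) (𝓡 n) (Sphere n) (Sphere n) ∞,
      IsConformalOn (roundMetric n) (roundMetric n) ψ univ ∧
      ∀ x y : Model n, 1 + 2 * ⟪b, y⟫_ℝ + ⟪y, y⟫_ℝ * ⟪b, b⟫_ℝ ≠ 0 →
        (1 + 2 * ⟪b, y⟫_ℝ + ⟪y, y⟫_ℝ * ⟪b, b⟫_ℝ) • K x = y + ⟪y, y⟫_ℝ • b →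
        ψ ((stereo v).toDiffeo x) = (stereo w).toDiffeo y := by
  let L₀ : Ambient n × ℝ →ₗ[ℝ] Ambient n × ℝ :=
    (fromNull w).comp ((specialNull b K k).comp (toNull v))
  have hL₀ : IsLorentz L₀ k := by
    refine ⟨hk, fun z z' => ?_⟩
    simp only [L₀, LinearMap.comp_apply]
    rw [form_fromNull, nullForm_specialNull b hK, nullForm_toNull]
    ring
  let L := LinearEquiv.ofInjectiveEndo L₀ hL₀.injective
  have hLL : L.toLinearMap = L₀ := LinearMap.ext fun _ => rfl
  have hL : IsLorentz L.toLinearMap k := hLL.symm ▸ hL₀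
  refine ⟨mobiusDiffeo hL, isConformalOn_mobius hL, fun x y hD hKx => Subtype.ext ?_⟩
  change mobiusVal L.toLinearMap ((stereo v).toDiffeo x) = _
  rw [coe_stereo, coe_stereo, hLL]
  set D := 1 + 2 * ⟪b, y⟫_ℝ + ⟪y, y⟫_ℝ * ⟪b, b⟫_ℝ with hDdef
  have hKx' : K x = D⁻¹ • (y + ⟪y, y⟫_ℝ • b) := by rw [← hKx, inv_smul_smul₀ hD]
  -- Both sides are `‖K x‖²`, because `‖y + ‖y‖² b‖² = D ‖y‖²`.
  have hkx : k ^ 2 * ‖x‖ ^ 2 = D⁻¹ * ‖y‖ ^ 2 := by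
    rw [← real_inner_self_eq_norm_sq, ← hK, hKx', ← real_inner_self_eq_norm_sq]
    simp only [inner_smul_left, inner_smul_right, inner_add_left, inner_add_right,
      RCLike.conj_to_real, real_inner_comm b y]
    field_simp
    rw [hDdef]
    ring
  -- The transformation with parameter `-b` undoes the one with parameter `b`, so the null vector of
  -- `x` goes to a multiple of that of `y`.
  have hN : specialNull b K k (x, ‖x‖ ^ 2, (1 : ℝ)) = D⁻¹ • (y, ‖y‖ ^ 2, (1 : ℝ)) := by
    refine Prod.ext ?_ (Prod.ext ?_ ?_)
    · simp only [specialNull, LinearMap.coe_mk, AddHom.coe_mk, hkx, hKx', Prod.smul_fst,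
        real_inner_self_eq_norm_sq]
      module
    · simp only [specialNull, LinearMap.coe_mk, AddHom.coe_mk, hkx, Prod.smul_fst, Prod.smul_snd,
        smul_eq_mul]
    · simp only [specialNull, LinearMap.coe_mk, AddHom.coe_mk, hkx, hKx', Prod.smul_snd,
        smul_eq_mul, inner_smul_right, inner_add_right]
      rw [← real_inner_self_eq_norm_sq y]
      field_simp
      rw [hDdef]
      ring
  have hLx : L₀ (stereoVal v x, 1) =
      ((‖x‖ ^ 2 + 4)⁻¹ * D⁻¹ * (‖y‖ ^ 2 + 4)) • (stereoVal w y, (1 : ℝ)) := by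
    simp only [L₀, LinearMap.comp_apply]
    rw [toNull_stereoVal, map_smul, hN, map_smul, map_smul, fromNull_null, smul_smul, smul_smul,
      mul_assoc]
  have hne : (‖x‖ ^ 2 + 4)⁻¹ * D⁻¹ * (‖y‖ ^ 2 + 4) ≠ 0 := by positivity
  rw [mobiusVal, hLx]
  simp only [Prod.smul_fst, Prod.smul_snd, smul_eq_mul, mul_one]
  rw [inv_smul_smul₀ hne]

end

/-! ### Straightening a quadratic field to the Euler field -/

section

variable {n : ℕ}

/-- A map that is mapped to itself by the radial derivative is linear. -/
theorem eq_fderiv_of_radial {E : Type*} [NormedAddCommGroup E] [NormedSpace ℝ E] {G : E → E}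
    {r : ℝ} (hd : ∀ x ∈ Metric.ball (0 : E) r, DifferentiableAt ℝ G x)
    (h : ∀ x ∈ Metric.ball (0 : E) r, fderiv ℝ G x x = G x) {x : E}
    (hx : x ∈ Metric.ball (0 : E) r) : G x = fderiv ℝ G 0 x := by
  have hr : 0 < r := Metric.pos_of_mem_ball hx
  have h0 : G 0 = 0 := by
    rw [← h 0 (Metric.mem_ball_self hr), map_zero]
  let s : Set ℝ := Ioi 0 ∩ {t | t • x ∈ Metric.ball (0 : E) r}
  have hs : IsOpen s := isOpen_Ioi.inter (Metric.isOpen_ball.preimage (by fun_prop))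
  have hsc : Convex ℝ s := (convex_Ioi 0).inter
    ((convex_ball (0 : E) r).linear_preimage (LinearMap.toSpanSingleton ℝ E x))
  -- On the positive part of the ray `t⁻¹ • G (t • x)` is constant. Its value at `t = 1` is `G x`,
  -- and its limit at `0` is the derivative of `G` at `0` applied to `x`.
  have hder : ∀ t ∈ s, HasDerivAt (fun t : ℝ => t⁻¹ • G (t • x)) 0 t := by
    intro t ht
    have ht0 : t ≠ 0 := (mem_Ioi.1 ht.1).ne'
    have h1 : HasDerivAt (fun t : ℝ => t • x) x t := by
      simpa using (hasDerivAt_id t).smul_const x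
    have h2 := (hd _ ht.2).hasFDerivAt.comp_hasDerivAt t h1
    have h3 := (hasDerivAt_inv ht0).smul h2
    have h4 : fderiv ℝ G (t • x) x = t⁻¹ • G (t • x) := by
      rw [← h _ ht.2, map_smul, inv_smul_smul₀ ht0]
    refine h3.congr_deriv ?_
    simp only [Function.comp_apply, h4, smul_smul]
    rw [← add_smul]
    have : t⁻¹ * t⁻¹ + -(t ^ 2)⁻¹ = 0 := by field_simp; ring
    rw [this, zero_smul]
  obtain ⟨c, hc⟩ := hs.exists_is_const_of_fderiv_eq_zero hsc.isPreconnected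
    (fun t ht => (hder t ht).differentiableAt.differentiableWithinAt)
    (fun t ht => by
      ext
      simpa using (hder t ht).deriv)
  have h1s : (1 : ℝ) ∈ s := ⟨mem_Ioi.2 one_pos, by simpa using hx⟩
  have hG : G x = c := by simpa using hc 1 h1s
  have hline : HasDerivAt (fun t : ℝ => G (t • x)) (fderiv ℝ G 0 x) 0 := by
    have h1 : HasDerivAt (fun t : ℝ => t • x) x 0 := by
      simpa using (hasDerivAt_id (0 : ℝ)).smul_const x
    have h2 := hd 0 (Metric.mem_ball_self hr)
    rw [← zero_smul ℝ x] at h2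
    have h3 := h2.hasFDerivAt.comp_hasDerivAt (0 : ℝ) h1
    rwa [zero_smul] at h3
  have hlim := hline.tendsto_slope_zero_right
  simp only [zero_add, zero_smul, h0, sub_zero] at hlim
  have hev : ∀ᶠ t in 𝓝[>] (0 : ℝ), t⁻¹ • G (t • x) = c := by
    have hcont : Continuous fun t : ℝ => t • x := by fun_prop
    have hnear : ∀ᶠ t in 𝓝 (0 : ℝ), t • x ∈ Metric.ball (0 : E) r :=
      hcont.continuousAt.eventually_mem (Metric.isOpen_ball.mem_nhds (by simpa using hr))
    filter_upwards [self_mem_nhdsWithin, nhdsWithin_le_nhds hnear] with t ht ht'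
    exact hc t ⟨ht, ht'⟩
  rw [hG]
  exact tendsto_nhds_unique (tendsto_const_nhds.congr' (hev.mono fun t ht => ht.symm)) hlim

/-- The denominator of the special conformal transformation with parameter `b`. -/
def specialDenom (b y : Model n) : ℝ := 1 + 2 * ⟪b, y⟫_ℝ + ⟪y, y⟫_ℝ * ⟪b, b⟫_ℝ

/-- The special conformal transformation with parameter `b`. -/
def specialMap (b y : Model n) : Model n := (specialDenom b y)⁻¹ • (y + ⟪y, y⟫_ℝ • b)

theorem hasFDerivAt_specialMap (b : Model n) {y : Model n} (hy : specialDenom b y ≠ 0) :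
    ∃ T : Model n →L[ℝ] Model n, HasFDerivAt (specialMap b) T y ∧ ∀ h,
      T h = (specialDenom b y)⁻¹ • (h + (2 * ⟪y, h⟫_ℝ) • b)
        - ((specialDenom b y)⁻¹ ^ 2 * (2 * ⟪b, h⟫_ℝ + 2 * ⟪y, h⟫_ℝ * ⟪b, b⟫_ℝ)) •
          (y + ⟪y, y⟫_ℝ • b) := by
  have h1 : HasFDerivAt (fun y : Model n => 2 * ⟪b, y⟫_ℝ) ((2 : ℝ) • innerSL ℝ b) y :=
    ((innerSL ℝ b).hasFDerivAt).const_mul 2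
  have h2 : HasFDerivAt (fun y : Model n => ⟪y, y⟫_ℝ) ((2 : ℝ) • innerSL ℝ y) y := by
    simp only [real_inner_self_eq_norm_sq]
    refine (hasStrictFDerivAt_norm_sq y).hasFDerivAt.congr_fderiv ?_
    ext1 h
    simp
  have h3 : HasFDerivAt (specialDenom b) ((2 : ℝ) • innerSL ℝ b +
      ⟪b, b⟫_ℝ • ((2 : ℝ) • innerSL ℝ y)) y := by
    exact (h1.const_add 1).add (h2.mul_const ⟪b, b⟫_ℝ)
  have h4 := ((hasFDerivAt_inv hy).comp y h3).smul ((hasFDerivAt_id y).add (h2.smul_const b))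
  refine ⟨_, h4, fun h => ?_⟩
  simp [sub_eq_add_neg]
  module

/-- A flat conformal map that preserves the Euler field up to a quadratic field with the same
1-jet is a special conformal transformation after a linear map. -/
theorem eventually_specialMap_eq {F : Model n → Model n}
    (hF : ContDiffAt ℝ ∞ F 0) (h0 : F 0 = 0)
    (hs : Function.Surjective (fderiv ℝ F 0)) {a b : Model n} {l : ℝ} {B : Model n →L[ℝ] Model n}
    (h : ∀ᶠ x in 𝓝 (0 : Model n), fderiv ℝ F x x = quadField a b l B (F x)) :
    ∀ᶠ x in 𝓝 (0 : Model n), specialDenom b (F x) ≠ 0 ∧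
      specialMap b (F x) = fderiv ℝ F 0 x := by
  have ha : a = 0 := by
    have := h.self_of_nhds
    rw [map_zero, h0] at this
    simpa [quadField] using this.symm
  -- Differentiating the relation at `0` gives `DF(0) = (B + l) DF(0)`, and `DF(0)` is onto.
  have hB : ∀ w, B w + l • w = w := by
    intro w
    obtain ⟨u, rfl⟩ := hs w
    have hd : DifferentiableAt ℝ (fderiv ℝ F) 0 := (contDiffAt_fderiv hF).differentiableAt (by simp)
    have h1 : HasFDerivAt (fun x => fderiv ℝ F x x) (fderiv ℝ F 0) 0 := by
      refine (hd.hasFDerivAt.clm_apply (hasFDerivAt_id (0 : Model n))).congr_fderiv ?_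
      ext1 v
      simp
    have h2 : HasFDerivAt (fun x => quadField a b l B (F x))
        ((quadDeriv b l B (F 0)).comp (fderiv ℝ F 0)) 0 :=
      (hasFDerivAt_quadField a b l B (F 0)).comp 0 (hF.differentiableAt (by simp)).hasFDerivAt
    have h3 := (h1.congr_of_eventuallyEq (h.mono fun x hx => hx.symm)).unique h2
    have h4 := congrArg (fun T : Model n →L[ℝ] Model n => T u) h3
    simp only [ContinuousLinearMap.comp_apply, quadDeriv_apply, h0] at h4
    simpa using h4.symm
  have hQ : ∀ y, quadField a b l B y = y + (2 * ⟪b, y⟫_ℝ) • y - ⟪y, y⟫_ℝ • b := by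
    intro y
    rw [quadField, ha, zero_add, hB, real_inner_self_eq_norm_sq]
  have hcF : Tendsto F (𝓝 0) (𝓝 0) := by
    have := hF.continuousAt
    rwa [ContinuousAt, h0] at this
  have hden : ∀ᶠ y in 𝓝 (0 : Model n), specialDenom b y ≠ 0 := by
    have hc : Continuous (specialDenom b) := by
      unfold specialDenom
      fun_prop
    exact hc.continuousAt.eventually_ne (by simp [specialDenom])
  have hden' := hcF.eventually hden
  have hdF : ∀ᶠ x in 𝓝 (0 : Model n), DifferentiableAt ℝ F x := by
    filter_upwards [(hF.of_le (m := 1) (by simp)).eventually (by simp)] with x hx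
    exact hx.differentiableAt (by simp)
  obtain ⟨r, hr, hball⟩ := Metric.eventually_nhds_iff_ball.1 (h.and (hden'.and hdF))
  have hG : ∀ x ∈ Metric.ball (0 : Model n) r, ∃ T : Model n →L[ℝ] Model n,
      HasFDerivAt (fun x => specialMap b (F x)) (T.comp (fderiv ℝ F x)) x ∧ ∀ h,
      T h = (specialDenom b (F x))⁻¹ • (h + (2 * ⟪F x, h⟫_ℝ) • b)
        - ((specialDenom b (F x))⁻¹ ^ 2 * (2 * ⟪b, h⟫_ℝ + 2 * ⟪F x, h⟫_ℝ * ⟪b, b⟫_ℝ)) •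
          (F x + ⟪F x, F x⟫_ℝ • b) := by
    intro x hx
    obtain ⟨T, hT, hT'⟩ := hasFDerivAt_specialMap b (hball x hx).2.1
    exact ⟨T, hT.comp x (hball x hx).2.2.hasFDerivAt, hT'⟩
  -- The map `specialMap b` carries `y + 2 ⟪b, y⟫ y - ‖y‖² b` to the Euler field. Its composite with
  -- `F` therefore preserves the Euler field, so it is linear on the ball.
  have hlin : ∀ x ∈ Metric.ball (0 : Model n) r,
      specialMap b (F x) = fderiv ℝ (fun x => specialMap b (F x)) 0 x := by
    intro x hx
    refine eq_fderiv_of_radial (G := fun x => specialMap b (F x)) (fun z hz => ?_) (fun z hz => ?_) hx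
    · obtain ⟨T, hT, -⟩ := hG z hz
      exact hT.differentiableAt
    · obtain ⟨T, hT, hT'⟩ := hG z hz
      obtain ⟨hz1, hz2, -⟩ := hball z hz
      rw [hT.fderiv, ContinuousLinearMap.comp_apply, hz1, hQ, hT', specialMap]
      set y := F z
      set D := specialDenom b y with hD
      have hD' : D = 1 + 2 * ⟪b, y⟫_ℝ + ⟪y, y⟫_ℝ * ⟪b, b⟫_ℝ := rfl
      simp only [inner_add_right, inner_sub_right, inner_smul_right, real_inner_comm b y]
      match_scalars <;> field_simp <;> rw [hD'] <;> ring
  -- The derivative of `specialMap b` at `0` is the identity, so the linear map is `DF(0)`.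
  have hder0 : fderiv ℝ (fun x => specialMap b (F x)) 0 = fderiv ℝ F 0 := by
    obtain ⟨T, hT, hT'⟩ := hG 0 (Metric.mem_ball_self hr)
    rw [hT.fderiv]
    ext1 u
    rw [ContinuousLinearMap.comp_apply, hT', h0]
    simp [specialDenom]
  filter_upwards [Metric.ball_mem_nhds (0 : Model n) hr] with x hx
  exact ⟨(hball x hx).2.1, by rw [hlin x hx, hder0]⟩

end

/-! ### Liouville's theorem on the sphere -/

section

variable {n : ℕ}
  {M : Type*} [TopologicalSpace M] [ChartedSpace (Model n) M] [IsManifold (𝓡 n) ∞ M]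
  {N : Type*} [TopologicalSpace N] [ChartedSpace (Model n) N] [IsManifold (𝓡 n) ∞ N]
  {P : Type*} [TopologicalSpace P] [ChartedSpace (Model n) P] [IsManifold (𝓡 n) ∞ P]
  {γ : RiemMetric n M} {γ' : RiemMetric n N} {γ'' : RiemMetric n P}

attribute [local instance] fact_finrank_ambient

theorem ConfLoc.tendsto (φ : ConfLoc γ γ') {p : M} (hp : p ∈ φ.toDiffeo.source) :
    Tendsto φ.toDiffeo (𝓝 p) (𝓝 (φ.toDiffeo p)) :=
  (contMDiffAt_partialDiffeo φ.toDiffeo hp).continuousAt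

theorem ConfLoc.symm_apply (φ : ConfLoc γ γ') {p : M} (hp : p ∈ φ.toDiffeo.source) :
    φ.symm.toDiffeo (φ.toDiffeo p) = p := φ.toDiffeo.left_inv hp

theorem ConfLoc.apply_symm (φ : ConfLoc γ γ') {q : N} (hq : q ∈ φ.toDiffeo.target) :
    φ.toDiffeo (φ.symm.toDiffeo q) = q := φ.toDiffeo.right_inv hq

theorem ConfLoc.tendsto_symm (φ : ConfLoc γ γ') {p : M} (hp : p ∈ φ.toDiffeo.source) :
    Tendsto φ.symm.toDiffeo (𝓝 (φ.toDiffeo p)) (𝓝 p) := by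
  have := φ.symm.tendsto (φ.toDiffeo.map_source hp)
  rwa [φ.symm_apply hp] at this

/-- `φ` maps the field `Y` to `Y'` near `p`. -/
def PushesNear (φ : ConfLoc γ γ') (p : M) (Y : M → Model n) (Y' : N → Model n) : Prop :=
  p ∈ φ.toDiffeo.source ∧ ∀ᶠ q in 𝓝 p, diffAt n φ.toDiffeo q (Y q) = Y' (φ.toDiffeo q)

theorem PushesNear.symm {φ : ConfLoc γ γ'} {p : M} {Y : M → Model n} {Y' : N → Model n}
    (h : PushesNear φ p Y Y') : PushesNear φ.symm (φ.toDiffeo p) Y' Y := by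
  refine ⟨φ.toDiffeo.map_source h.1, ?_⟩
  filter_upwards [(φ.tendsto_symm h.1).eventually h.2,
    φ.toDiffeo.open_target.mem_nhds (φ.toDiffeo.map_source h.1)] with q hq hqt
  rw [φ.apply_symm hqt] at hq
  rw [← hq]
  have hr : φ.toDiffeo (φ.toDiffeo.symm q) = q := φ.toDiffeo.right_inv hqt
  have h1 := diffAt_symm_diffAt φ.toDiffeo (φ.toDiffeo.map_target hqt) (Y (φ.toDiffeo.symm q))
  erw [hr] at h1
  exact h1

theorem PushesNear.trans {φ : ConfLoc γ γ'} {ψ : ConfLoc γ' γ''} {p : M} {Y : M → Model n}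
    {Y' : N → Model n} {Y'' : P → Model n} (h : PushesNear φ p Y Y')
    (h' : PushesNear ψ (φ.toDiffeo p) Y' Y'') : PushesNear (φ.trans ψ) p Y Y'' := by
  have hs : p ∈ (φ.trans ψ).toDiffeo.source := ⟨h.1, h'.1⟩
  refine ⟨hs, ?_⟩
  filter_upwards [h.2, (φ.tendsto h.1).eventually h'.2,
    (φ.trans ψ).toDiffeo.open_source.mem_nhds hs] with q hq hq' hqs
  rw [φ.diffAt_trans ψ hqs.1 hqs.2, ContinuousLinearMap.comp_apply, hq, hq']
  rfl

theorem pushesNear_refl (γ : RiemMetric n M) (p : M) (Y : M → Model n) :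
    PushesNear (ConfLoc.refl γ) p Y Y :=
  ⟨mem_univ p, .of_forall fun q => congrArg (fun T : Model n →L[ℝ] Model n => T (Y q)) (diffAt_id q)⟩

theorem PushesNear.eventually {φ : ConfLoc γ γ'} {p : M} {Y : M → Model n} {Y' : N → Model n}
    (h : PushesNear φ p Y Y') : ∀ᶠ q in 𝓝 p, PushesNear φ q Y Y' := by
  filter_upwards [φ.toDiffeo.open_source.mem_nhds h.1, eventually_eventually_nhds.2 h.2]
    with q hq hq'
  exact ⟨hq, hq'⟩

theorem pushesNear_pullField (φ : ConfLoc γ γ') {p : M} (hp : p ∈ φ.toDiffeo.source)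
    (Y : N → Model n) : PushesNear φ p (pullField φ.toDiffeo Y) Y :=
  ⟨hp, eventually_of_mem (φ.toDiffeo.open_source.mem_nhds hp)
    fun _ hq => diffAt_pullField φ.toDiffeo hq Y⟩

/-- A global conformal diffeomorphism, as a conformal map. -/
def ConfLoc.ofDiffeomorph (ψ : Diffeomorph (𝓡 n) (𝓡 n) M N ∞) (h : IsConformalOn γ γ' ψ univ) :
    ConfLoc γ γ' where
  toDiffeo := ψ.toPartialDiffeomorph
  isConformal := h

theorem stereo_neg_zero (p : Sphere n) : (stereo (-p)).toDiffeo (0 : Model n) = p := by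
  refine Subtype.ext ?_
  rw [coe_stereo]
  simp [stereoVal, smul_smul]

theorem stereo_neg_symm (p : Sphere n) : (stereo (-p)).symm.toDiffeo p = (0 : Model n) := by
  have := (stereo (-p)).symm_apply (mem_stereo_source (-p) 0)
  rwa [stereo_neg_zero] at this

theorem mem_stereo_neg_target (p : Sphere n) : p ∈ (stereo (-p)).toDiffeo.target := by
  rw [stereo_target]
  simpa using ne_neg_of_mem_unit_sphere ℝ p

/-- Liouville's theorem: conformal maps of the sphere extend locally to the whole sphere. -/
theorem exists_diffeomorph_eventuallyEq (hn : 2 < n)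
    (φ : ConfLoc (roundMetric n) (roundMetric n)) {p : Sphere n} (hp : p ∈ φ.toDiffeo.source) :
    ∃ ψ : Diffeomorph (𝓡 n) (𝓡 n) (Sphere n) (Sphere n) ∞,
      IsConformalOn (roundMetric n) (roundMetric n) ψ univ ∧
      ∀ᶠ q in 𝓝 p, ψ q = φ.toDiffeo q := by
  let v : Sphere n := -p
  let w : Sphere n := -φ.toDiffeo p
  -- The map `φ` in charts centred at `p` and `φ p`, so that `Θ` fixes the origin.
  let Θ : ConfLoc (flatMetric n) (flatMetric n) := (stereo v).trans (φ.trans (stereo w).symm)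
  have hv0 : (stereo v).toDiffeo 0 = p := stereo_neg_zero p
  have h0s : (0 : Model n) ∈ Θ.toDiffeo.source := by
    refine ⟨mem_stereo_source v 0, ?_⟩
    change (stereo v).toDiffeo 0 ∈ (φ.trans (stereo w).symm).toDiffeo.source
    rw [hv0]
    exact ⟨hp, mem_stereo_neg_target _⟩
  have hΘ : ∀ x, Θ.toDiffeo x = (stereo w).symm.toDiffeo (φ.toDiffeo ((stereo v).toDiffeo x)) :=
    fun x => rfl
  have hΘ0 : Θ.toDiffeo 0 = 0 := by
    rw [hΘ, hv0]
    exact stereo_neg_symm _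
  -- The Euler field is `quadField 0 0 1 0`. Its pullback by the inverse of `Θ` is its pushforward
  -- by `Θ`, which is conformal Killing and hence quadratic near `0`.
  have hE : IsCKVFOn (flatMetric n) (quadField (0 : Model n) 0 1 0) univ :=
    isCKVFOn_quadField 0 0 1 fun u v => by simp
  have hpull := hE.pull Θ.symm isOpen_univ
  rw [preimage_univ, inter_univ] at hpull
  have h0t : (0 : Model n) ∈ Θ.toDiffeo.target := by
    have := Θ.toDiffeo.map_source h0s
    rwa [hΘ0] at this
  obtain ⟨r, hr, hrs⟩ := Metric.isOpen_iff.1 Θ.toDiffeo.open_target 0 h0t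
  obtain ⟨a, b, l, B, -, he⟩ := (hpull.mono hrs).exists_eqOn_quadField hn
    Metric.isOpen_ball (convex_ball (0 : Model n) r).isPreconnected
  have hF : ContDiffAt ℝ ∞ Θ.toDiffeo 0 :=
    contMDiffAt_iff_contDiffAt.1 (contMDiffAt_partialDiffeo Θ.toDiffeo h0s)
  have hpn : PushesNear Θ 0 (fun x => x) (pullField Θ.symm.toDiffeo (fun x => x)) := by
    have h1 := (pushesNear_pullField Θ.symm (Θ.toDiffeo.map_source h0s) (fun x => x)).symm
    rwa [Θ.symm_apply h0s] at h1
  have hid : quadField (0 : Model n) 0 1 0 = fun x => x := by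
    ext1 x
    simp [quadField]
  rw [hid] at he
  have htend : Tendsto Θ.toDiffeo (𝓝 0) (𝓝 0) := by
    have := Θ.tendsto h0s
    rwa [hΘ0] at this
  have hmain : ∀ᶠ x in 𝓝 (0 : Model n),
      fderiv ℝ Θ.toDiffeo x x = quadField a b l B (Θ.toDiffeo x) := by
    filter_upwards [hpn.2, htend.eventually (Metric.ball_mem_nhds 0 hr)] with x hx hx'
    rw [← he hx', ← hx, diffAt_eq_fderiv]
  have hsurj : Function.Surjective (fderiv ℝ Θ.toDiffeo 0) := fun u => by
    refine ⟨diffAt n Θ.toDiffeo.symm (Θ.toDiffeo 0) u, ?_⟩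
    rw [← diffAt_eq_fderiv]
    exact diffAt_diffAt_symm Θ.toDiffeo h0s u
  have hspec := eventually_specialMap_eq hF hΘ0 hsurj hmain
  -- The derivative of `Θ` at the origin is a similarity, as the extension to the sphere requires.
  obtain ⟨k, -, hk⟩ := isConformalOn_iff.1 Θ.isConformal
  obtain ⟨hk0, hkK⟩ := hk 0 h0s
  have hK : ∀ x y, ⟪fderiv ℝ Θ.toDiffeo 0 x, fderiv ℝ Θ.toDiffeo 0 y⟫_ℝ = k 0 ^ 2 * ⟪x, y⟫_ℝ := by
    intro x y
    rw [← diffAt_eq_fderiv]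
    exact hkK x y
  obtain ⟨ψ, hψ, hψe⟩ := exists_diffeomorph_special v w b hk0 hK
  refine ⟨ψ, hψ, ?_⟩
  have hnear : ∀ᶠ x in 𝓝 (0 : Model n),
      ψ ((stereo v).toDiffeo x) = φ.toDiffeo ((stereo v).toDiffeo x) := by
    filter_upwards [hspec, Θ.toDiffeo.open_source.mem_nhds h0s] with x hx hxs
    rw [hψe x (Θ.toDiffeo x) hx.1 ?_]
    · exact (stereo w).apply_symm hxs.2.2
    · rw [← hx.2, specialMap]
      exact smul_inv_smul₀ hx.1 _
  have hts := (stereo v).tendsto_symm (mem_stereo_source v 0)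
  rw [hv0] at hts
  filter_upwards [hts.eventually hnear,
    (stereo v).toDiffeo.open_target.mem_nhds (mem_stereo_neg_target p)] with q hq hqt
  rwa [(stereo v).apply_symm hqt] at hq

/-- Near `p` the map agrees with a global conformal `ψ`. The fields `ψ_* ζ` and `ζ'` then agree near
the image of `p`, hence everywhere. -/
theorem globallyConformal_of_pushesNear (hn : 2 < n)
    {φ : ConfLoc (roundMetric n) (roundMetric n)} {p : Sphere n}
    {ζ ζ' : GlobalCKVF (roundMetric n)} (h : PushesNear φ p ζ.field ζ'.field) :
    GloballyConformal (roundMetric n) ζ ζ' := by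
  obtain ⟨ψ, hψ, he⟩ := exists_diffeomorph_eventuallyEq hn φ h.1
  let Ψ : ConfLoc (roundMetric n) (roundMetric n) := ConfLoc.ofDiffeomorph ψ hψ
  have hΨ : ∀ q, q ∈ Ψ.toDiffeo.source := mem_univ
  have hpull := ζ.isCKVF.pull Ψ.symm isOpen_univ
  rw [preimage_univ, inter_univ] at hpull
  let ζ'' : GlobalCKVF (roundMetric n) := ⟨pullField Ψ.symm.toDiffeo ζ.field, hpull⟩
  have hp : ∀ q, PushesNear Ψ q ζ.field ζ''.field := by
    intro q
    have h1 := (pushesNear_pullField Ψ.symm (Ψ.toDiffeo.map_source (hΨ q)) ζ.field).symm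
    rwa [Ψ.symm_apply (hΨ q)] at h1
  have heq : ζ'' = ζ' := by
    refine global_ext_of_eventuallyEq hn (p := Ψ.toDiffeo p) ?_
    have h1 : ∀ᶠ q in 𝓝 p, ζ''.field (Ψ.toDiffeo q) = ζ'.field (Ψ.toDiffeo q) := by
      filter_upwards [h.2, eventually_eventually_nhds.2 he] with q hq hq'
      have h2 := (hp q).2.self_of_nhds
      have h3 : diffAt n Ψ.toDiffeo q = diffAt n φ.toDiffeo q := diffAt_congr hq'
      have h4 : Ψ.toDiffeo q = φ.toDiffeo q := hq'.self_of_nhds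
      rw [h3, hq, ← h4] at h2
      exact h2.symm
    filter_upwards [(Ψ.tendsto_symm (hΨ p)).eventually h1] with y hy
    rwa [Ψ.apply_symm (mem_univ y)] at hy
  refine ⟨ψ, hψ, fun q _ => ?_⟩
  rw [← heq]
  exact (hp q).2.self_of_nhds

end

/-! ### The map of conformal classes and its bijectivity -/

section

variable {n : ℕ}
  {M : Type*} [TopologicalSpace M] [ChartedSpace (Model n) M] [IsManifold (𝓡 n) ∞ M]
  {γ : RiemMetric n M}

theorem assignedAt_iff {Y : LocalCKVF γ} {χ : ConfLoc γ (roundMetric n)} {p : M}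
    {ζ : GlobalCKVF (roundMetric n)} :
    AssignedAt Y χ p ζ ↔ p ∈ Y.domain ∧ PushesNear χ p Y.field ζ.field := by
  constructor
  · rintro ⟨U, hU, hp, hs, h⟩
    exact ⟨(hs hp).1, (hs hp).2, eventually_of_mem (hU.mem_nhds hp) h⟩
  · rintro ⟨hp, hs, h⟩
    obtain ⟨U, hU, hUo, hpU⟩ := eventually_nhds_iff.1 h
    exact ⟨U ∩ (Y.domain ∩ χ.toDiffeo.source),
      hUo.inter (Y.isOpen.inter χ.toDiffeo.open_source), ⟨hpU, hp, hs⟩, inter_subset_right,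
      fun x hx => hU x hx.1⟩

/-- The field `χ_* Y` is conformal Killing near `χ p`, so the extension and uniqueness theorems on
the sphere apply. -/
theorem existsUnique_pushesNear (hn : 2 < n) (Y : LocalCKVF γ) (χ : ConfLoc γ (roundMetric n))
    {p : M} (hp : p ∈ Y.domain) (hs : p ∈ χ.toDiffeo.source) :
    ∃! ζ : GlobalCKVF (roundMetric n), PushesNear χ p Y.field ζ.field := by
  have hmem : χ.toDiffeo p ∈ χ.symm.toDiffeo.source ∩ χ.symm.toDiffeo ⁻¹' Y.domain := by
    refine ⟨χ.toDiffeo.map_source hs, ?_⟩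
    rw [mem_preimage, χ.symm_apply hs]
    exact hp
  obtain ⟨ζ, hζ⟩ := exists_global_eventuallyEq hn (isOpen_source_inter_preimage χ.symm Y.isOpen)
    (Y.isCKVF.pull χ.symm Y.isOpen) hmem
  have h1 := (pushesNear_pullField χ.symm (χ.toDiffeo.map_source hs) Y.field).symm
  rw [χ.symm_apply hs] at h1
  have h2 : PushesNear χ p Y.field ζ.field := by
    refine ⟨hs, ?_⟩
    filter_upwards [h1.2, (χ.tendsto hs).eventually hζ] with q hq hq'
    rw [hq']
    exact hq
  refine ⟨ζ, h2, fun ζ' h' => global_ext_of_eventuallyEq hn (p := χ.toDiffeo p) ?_⟩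
  have h3 : ∀ᶠ q in 𝓝 p, ζ'.field (χ.toDiffeo q) = ζ.field (χ.toDiffeo q) := by
    filter_upwards [h2.2, h'.2] with q hq hq'
    rw [← hq, ← hq']
  filter_upwards [(χ.tendsto_symm hs).eventually h3,
    χ.toDiffeo.open_target.mem_nhds (χ.toDiffeo.map_source hs)] with y hy hyt
  rwa [χ.apply_symm hyt] at hy

/-- The local conformal map `χ' ∘ φ ∘ χ⁻¹` of the sphere takes `ζ` to `ζ'` near `χ p`. -/
theorem globallyConformal_of_local (hn : 2 < n) {φ : ConfLoc γ γ}
    {χ χ' : ConfLoc γ (roundMetric n)} {p : M} {Y Y' : M → Model n}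
    {ζ ζ' : GlobalCKVF (roundMetric n)} (h : PushesNear φ p Y Y')
    (hχ : PushesNear χ p Y ζ.field) (hχ' : PushesNear χ' (φ.toDiffeo p) Y' ζ'.field) :
    GloballyConformal (roundMetric n) ζ ζ' := by
  have h1 : PushesNear (φ.trans χ') (χ.symm.toDiffeo (χ.toDiffeo p)) Y ζ'.field := by
    rw [χ.symm_apply hχ.1]
    exact h.trans hχ'
  exact globallyConformal_of_pushesNear hn (hχ.symm.trans h1)

theorem globallyConformal_of_domain (hn : 2 < n) (hγ : IsLocallyConformallyFlat γ)
    (Y : LocalCKVF γ) {χ χ' : ConfLoc γ (roundMetric n)} {x y : M} (hx : x ∈ Y.domain)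
    (hy : y ∈ Y.domain) {ζ ζ' : GlobalCKVF (roundMetric n)} (h : PushesNear χ x Y.field ζ.field)
    (h' : PushesNear χ' y Y.field ζ'.field) : GloballyConformal (roundMetric n) ζ ζ' := by
  -- Quantifying over all charts makes the relation symmetric and, on the domain, transitive. It
  -- holds between a point and its neighbours because one chart serves both, so connectedness
  -- spreads it over the domain.
  let R : M → M → Prop := fun x y => ∀ (χ χ' : ConfLoc γ (roundMetric n))
    (ζ ζ' : GlobalCKVF (roundMetric n)), PushesNear χ x Y.field ζ.field →
      PushesNear χ' y Y.field ζ'.field → GloballyConformal (roundMetric n) ζ ζ'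
  have hex : ∀ z ∈ Y.domain, ∃ (χ : ConfLoc γ (roundMetric n))
      (ζ : GlobalCKVF (roundMetric n)), PushesNear χ z Y.field ζ.field := by
    intro z hz
    obtain ⟨χ, hχ⟩ := hγ z
    obtain ⟨ζ, hζ, -⟩ := existsUnique_pushesNear hn Y χ hz hχ
    exact ⟨χ, ζ, hζ⟩
  have key : R x y := by
    refine Y.isConnected.isPreconnected.induction₂ R (fun z hz => ?_)
      (fun a b c _ hb _ h₁ h₂ χ χ' ζ ζ' h h' => ?_) (fun a b _ _ h₁ χ χ' ζ ζ' h h' => ?_) hx hy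
    · obtain ⟨χ₀, ζ₀, h₀⟩ := hex z hz
      refine eventually_nhdsWithin_of_eventually_nhds ?_
      filter_upwards [h₀.eventually] with w hw χ χ' ζ ζ' h h'
      exact globallyConformal_trans _
        (globallyConformal_of_local hn (pushesNear_refl γ z Y.field) h h₀)
        (globallyConformal_of_local hn (pushesNear_refl γ w Y.field) hw h')
    · obtain ⟨χ₀, ζ₀, h₀⟩ := hex b hb
      exact globallyConformal_trans _ (h₁ χ χ₀ ζ ζ₀ h h₀) (h₂ χ₀ χ' ζ₀ ζ' h₀ h')
    · exact globallyConformal_symm _ (h₁ χ' χ ζ' ζ h' h)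
  exact key χ χ' ζ ζ' h h'

/-- `ζ` is the transport of `Y` to the sphere by some conformal map, which takes some point of the
domain of `Y` to `P`. -/
def TransportsTo (Y : LocalCKVF γ) (ζ : GlobalCKVF (roundMetric n)) (P : Sphere n) : Prop :=
  ∃ (χ : ConfLoc γ (roundMetric n)) (p : M), p ∈ Y.domain ∧ PushesNear χ p Y.field ζ.field ∧
    χ.toDiffeo p = P

theorem TransportsTo.globallyConformal (hn : 2 < n) (hγ : IsLocallyConformallyFlat γ)
    {Y : LocalCKVF γ} {ζ ζ' : GlobalCKVF (roundMetric n)} {P P' : Sphere n}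
    (h : TransportsTo Y ζ P) (h' : TransportsTo Y ζ' P') :
    GloballyConformal (roundMetric n) ζ ζ' := by
  obtain ⟨χ, p, hp, hχ, -⟩ := h
  obtain ⟨χ', p', hp', hχ', -⟩ := h'
  exact globallyConformal_of_domain hn hγ Y hp hp' hχ hχ'

theorem exists_transportsTo (hn : 2 < n) (hγ : IsLocallyConformallyFlat γ) (Y : LocalCKVF γ) :
    ∃ ζ P, TransportsTo Y ζ P := by
  obtain ⟨p, hp⟩ := Y.isConnected.nonempty
  obtain ⟨χ, hχ⟩ := hγ p
  obtain ⟨ζ, hζ, -⟩ := existsUnique_pushesNear hn Y χ hp hχ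
  exact ⟨ζ, _, χ, p, hp, hζ, rfl⟩

theorem LocallyConformal.globallyConformal (hn : 2 < n) (hγ : IsLocallyConformallyFlat γ)
    {Y Y' : LocalCKVF γ} (hY : LocallyConformal γ Y Y') {ζ ζ' : GlobalCKVF (roundMetric n)}
    {P P' : Sphere n} (h : TransportsTo Y ζ P) (h' : TransportsTo Y' ζ' P') :
    GloballyConformal (roundMetric n) ζ ζ' := by
  obtain ⟨φ, ⟨q, hq⟩, hs, ht, hφ⟩ := hY
  have hq' := φ.toDiffeo.map_source hq
  have h0 : PushesNear φ q Y.field Y'.field :=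
    ⟨hq, eventually_of_mem (φ.toDiffeo.open_source.mem_nhds hq) hφ⟩
  obtain ⟨χ, hχ⟩ := hγ q
  obtain ⟨χ', hχ'⟩ := hγ (φ.toDiffeo q)
  obtain ⟨ζ₁, h₁, -⟩ := existsUnique_pushesNear hn Y χ (hs hq) hχ
  obtain ⟨ζ₂, h₂, -⟩ := existsUnique_pushesNear hn Y' χ' (ht hq') hχ'
  have h₁' : TransportsTo Y ζ₁ _ := ⟨χ, q, hs hq, h₁, rfl⟩
  have h₂' : TransportsTo Y' ζ₂ _ := ⟨χ', _, ht hq', h₂, rfl⟩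
  exact globallyConformal_trans _ (h.globallyConformal hn hγ h₁')
    (globallyConformal_trans _ (globallyConformal_of_local hn h0 h₁ h₂)
      (h₂'.globallyConformal hn hγ h'))

theorem globallyConformal_of_eqvGen (hn : 2 < n) (hγ : IsLocallyConformallyFlat γ)
    {Y Y' : LocalCKVF γ} (hY : Relation.EqvGen (LocallyConformal γ) Y Y') :
    ∀ {ζ ζ' : GlobalCKVF (roundMetric n)} {P P' : Sphere n}, TransportsTo Y ζ P →
      TransportsTo Y' ζ' P' → GloballyConformal (roundMetric n) ζ ζ' := by
  induction hY with
  | rel Y Y' h => exact h.globallyConformal hn hγ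
  | refl Y => exact TransportsTo.globallyConformal hn hγ
  | symm Y Y' _ ih => exact fun h h' => globallyConformal_symm _ (ih h' h)
  | trans Y Y' Y'' _ _ ih ih' =>
    intro ζ ζ'' P P' h h'
    obtain ⟨ζ', Q, hQ⟩ := exists_transportsTo hn hγ Y'
    exact globallyConformal_trans _ (ih h hQ) (ih' hQ h')

/-- The map from local to global conformal classes. -/
def classMap (hn : 2 < n) (hγ : IsLocallyConformallyFlat γ) :
    Quotient (localSetoid γ) → Quotient (globalSetoid (roundMetric n)) :=
  Quotient.lift
    (fun Y => Quotient.mk (globalSetoid (roundMetric n)) (exists_transportsTo hn hγ Y).choose)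
    fun Y Y' h => Quotient.sound (globallyConformal_of_eqvGen hn hγ h
      (exists_transportsTo hn hγ Y).choose_spec.choose_spec
      (exists_transportsTo hn hγ Y').choose_spec.choose_spec)

theorem TransportsTo.classMap_eq (hn : 2 < n) (hγ : IsLocallyConformallyFlat γ) {Y : LocalCKVF γ}
    {ζ : GlobalCKVF (roundMetric n)} {P : Sphere n} (h : TransportsTo Y ζ P) :
    classMap hn hγ (Quotient.mk (localSetoid γ) Y) =
      Quotient.mk (globalSetoid (roundMetric n)) ζ :=
  Quotient.sound ((exists_transportsTo hn hγ Y).choose_spec.choose_spec.globallyConformal hn hγ h)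

/-- A global field on the sphere can be pulled back to a local one by a conformal map. -/
theorem exists_localCKVF_transportsTo (φ : ConfLoc γ (roundMetric n)) {p : M}
    (hp : p ∈ φ.toDiffeo.source) (ζ : GlobalCKVF (roundMetric n)) :
    ∃ Y : LocalCKVF γ, TransportsTo Y ζ (φ.toDiffeo p) := by
  have := ChartedSpace.locallyConnectedSpace (Model n) M
  have hpull := ζ.isCKVF.pull φ isOpen_univ
  rw [preimage_univ, inter_univ] at hpull
  let Y : LocalCKVF γ :=
    { domain := connectedComponentIn φ.toDiffeo.source p
      isOpen := φ.toDiffeo.open_source.connectedComponentIn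
      isConnected := isConnected_connectedComponentIn_iff.2 hp
      field := pullField φ.toDiffeo ζ.field
      isCKVF := hpull.mono (connectedComponentIn_subset _ _) }
  exact ⟨Y, φ, p, mem_connectedComponentIn hp, pushesNear_pullField φ hp ζ.field, rfl⟩

/-- Any point `P` can be reached, even if the given charts miss it: two stereographic projections
send `χ x` to the origin and then to `P`. -/
theorem exists_localCKVF (hγ : IsLocallyConformallyFlat γ) [Nonempty M]
    (ζ : GlobalCKVF (roundMetric n)) (P : Sphere n) : ∃ Y : LocalCKVF γ, TransportsTo Y ζ P := by
  obtain ⟨x⟩ := ‹Nonempty M›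
  obtain ⟨χ, hχ⟩ := hγ x
  let v : Sphere n := -χ.toDiffeo x
  let φ := χ.trans ((stereo v).symm.trans (stereo (-P)))
  have h0 : (stereo v).symm.toDiffeo (χ.toDiffeo x) = (0 : Model n) := stereo_neg_symm _
  have hs : x ∈ φ.toDiffeo.source := by
    refine ⟨hχ, mem_stereo_neg_target _, ?_⟩
    exact mem_stereo_source _ _
  have hP : φ.toDiffeo x = P :=
    (congrArg (stereo (-P)).toDiffeo h0).trans (stereo_neg_zero P)
  rw [← hP]
  exact exists_localCKVF_transportsTo φ hs ζ

theorem PushesNear.locallyConformal {Y Y' : LocalCKVF γ} {φ : ConfLoc γ γ} {p : M}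
    (h : PushesNear φ p Y.field Y'.field) (hp : p ∈ Y.domain)
    (hp' : φ.toDiffeo p ∈ Y'.domain) : LocallyConformal γ Y Y' := by
  obtain ⟨U, hU, hUo, hpU⟩ := eventually_nhds_iff.1 (h.2.and ((Y.isOpen.eventually_mem hp).and
    ((φ.tendsto h.1).eventually (Y'.isOpen.eventually_mem hp'))))
  refine ⟨φ.restr U hUo, ⟨p, h.1, hpU⟩, fun x hx => (hU x hx.2).2.1, fun y hy => ?_,
    fun x hx => (hU x hx.2).1⟩
  have h1 := (hU _ hy.2).2.2
  have h2 : φ.toDiffeo (φ.toDiffeo.symm y) = y := φ.toDiffeo.right_inv hy.1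
  rwa [← h2]

/-- With a common target point the two charts compose to the local conformal map `χ'⁻¹ ∘ χ` of `M`.
-/
theorem TransportsTo.locallyConformal {Y Y' : LocalCKVF γ} {ζ : GlobalCKVF (roundMetric n)}
    {P : Sphere n} (h : TransportsTo Y ζ P) (h' : TransportsTo Y' ζ P) :
    LocallyConformal γ Y Y' := by
  obtain ⟨χ, p, hp, hχ, hP⟩ := h
  obtain ⟨χ', p', hp', hχ', hP'⟩ := h'
  have h1 := hχ'.symm
  rw [hP', ← hP] at h1
  refine (hχ.trans h1).locallyConformal hp ?_
  change χ'.symm.toDiffeo (χ.toDiffeo p) ∈ Y'.domain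
  rwa [hP, ← hP', χ'.symm_apply hχ'.1]

theorem TransportsTo.eventually {Y : LocalCKVF γ} {ζ : GlobalCKVF (roundMetric n)} {P : Sphere n}
    (h : TransportsTo Y ζ P) : ∀ᶠ Q in 𝓝 P, TransportsTo Y ζ Q := by
  obtain ⟨χ, p, hp, hχ, rfl⟩ := h
  filter_upwards [(χ.tendsto_symm hχ.1).eventually (hχ.eventually.and (Y.isOpen.eventually_mem hp)),
    χ.toDiffeo.open_target.mem_nhds (χ.toDiffeo.map_source hχ.1)] with Q hQ hQt
  exact ⟨χ, _, hQ.2, hQ.1, χ.apply_symm hQt⟩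

theorem preconnectedSpace_sphere (hn : 2 < n) : PreconnectedSpace (Sphere n) := by
  refine Subtype.preconnectedSpace (isPreconnected_sphere ?_ _ _)
  rw [← Module.finrank_eq_rank, finrank_euclideanSpace_fin]
  exact_mod_cast (by omega : 1 < n + 1)

/-- Charts landing at different points `P` and `P'` need not compose. As the target point moves over
the connected sphere, local fields reaching each point supply a chain; each link holds because
reaching a point is an open condition. -/
theorem TransportsTo.eqvGen (hn : 2 < n) (hγ : IsLocallyConformallyFlat γ) [Nonempty M]
    {Y Y' : LocalCKVF γ} {ζ : GlobalCKVF (roundMetric n)} {P P' : Sphere n}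
    (h : TransportsTo Y ζ P) (h' : TransportsTo Y' ζ P') :
    Relation.EqvGen (LocallyConformal γ) Y Y' := by
  have := preconnectedSpace_sphere hn
  let R : Sphere n → Sphere n → Prop := fun P P' => ∀ Y Y' : LocalCKVF γ, TransportsTo Y ζ P →
    TransportsTo Y' ζ P' → Relation.EqvGen (LocallyConformal γ) Y Y'
  have key : R P P' := by
    refine isPreconnected_univ.induction₂ R (fun Q _ => ?_)
      (fun A B C _ _ _ h₁ h₂ Y Y' h h' => ?_) (fun A B _ _ h₁ Y Y' h h' => ?_)
      (mem_univ P) (mem_univ P')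
    · obtain ⟨Y₀, h₀⟩ := exists_localCKVF hγ ζ Q
      refine eventually_nhdsWithin_of_eventually_nhds ?_
      filter_upwards [h₀.eventually] with Q' hQ' Y Y' h h'
      exact .trans _ _ _ (.rel _ _ (h.locallyConformal h₀)) (.rel _ _ (hQ'.locallyConformal h'))
    · obtain ⟨Y₀, h₀⟩ := exists_localCKVF hγ ζ B
      exact .trans _ _ _ (h₁ Y Y₀ h h₀) (h₂ Y₀ Y' h₀ h')
    · exact .symm _ _ (h₁ Y' Y h' h)
  exact key Y Y' h h'

theorem TransportsTo.of_globallyConformal {Y : LocalCKVF γ}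
    {ζ ζ' : GlobalCKVF (roundMetric n)} {P : Sphere n} (h : TransportsTo Y ζ P)
    (hζ : GloballyConformal (roundMetric n) ζ ζ') : ∃ Q, TransportsTo Y ζ' Q := by
  obtain ⟨χ, p, hp, hχ, rfl⟩ := h
  obtain ⟨ψ, hψ, hpush⟩ := hζ
  have h1 : PushesNear (ConfLoc.ofDiffeomorph ψ hψ) (χ.toDiffeo p) ζ.field ζ'.field :=
    ⟨mem_univ _, .of_forall fun q => hpush q trivial⟩
  exact ⟨_, χ.trans (ConfLoc.ofDiffeomorph ψ hψ), p, hp, hχ.trans h1, rfl⟩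

theorem classMap_bijective (hn : 2 < n) (hγ : IsLocallyConformallyFlat γ) [Nonempty M] :
    Function.Bijective (classMap hn hγ) := by
  constructor
  · rintro ⟨Y⟩ ⟨Y'⟩ h
    obtain ⟨ζ, P, hY⟩ := exists_transportsTo hn hγ Y
    obtain ⟨ζ', P', hY'⟩ := exists_transportsTo hn hγ Y'
    have h1 : GloballyConformal (roundMetric n) ζ ζ' :=
      Quotient.exact ((hY.classMap_eq hn hγ).symm.trans (h.trans (hY'.classMap_eq hn hγ)))
    -- Composing the chart with the global diffeomorphism makes both local fields transport to the
    -- same `ζ'`.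
    obtain ⟨Q, hQ⟩ := hY.of_globallyConformal h1
    exact Quotient.sound (hQ.eqvGen hn hγ hY')
  · rintro ⟨ζ⟩
    obtain ⟨x⟩ := ‹Nonempty M›
    obtain ⟨χ, hχ⟩ := hγ x
    obtain ⟨Y, hY⟩ := exists_localCKVF_transportsTo χ hχ ζ
    exact ⟨Quotient.mk _ Y, hY.classMap_eq hn hγ⟩

end

end ConformalClasses

end

theorem propositionA1 {n : ℕ} (hn : 2 < n)
    {M : Type*} [TopologicalSpace M] [T2Space M] [ConnectedSpace M]
    [ChartedSpace (EuclideanSpace ℝ (Fin n)) M] [IsManifold (𝓡 n) ∞ M]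
    (γ : RiemMetric n M) (hγ : IsLocallyConformallyFlat γ) :
    ∃ Φ : Quotient (localSetoid γ) → Quotient (globalSetoid (roundMetric n)),
      Function.Bijective Φ ∧
      ∀ (Y : LocalCKVF γ) (χ : ConfLoc γ (roundMetric n)) (p : M),
        p ∈ Y.domain → p ∈ χ.toDiffeo.source →
          (∃! ζ : GlobalCKVF (roundMetric n), AssignedAt Y χ p ζ) ∧
          ∀ ζ : GlobalCKVF (roundMetric n), AssignedAt Y χ p ζ →
            Φ (Quotient.mk (localSetoid γ) Y) =
              Quotient.mk (globalSetoid (roundMetric n)) ζ := by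
  refine ⟨classMap hn hγ, classMap_bijective hn hγ, fun Y χ p hp hs => ⟨?_, fun ζ hζ => ?_⟩⟩
  · simpa only [assignedAt_iff, hp, true_and] using existsUnique_pushesNear hn Y χ hp hs
  · have h := assignedAt_iff.1 hζ
    exact TransportsTo.classMap_eq hn hγ ⟨χ, p, hp, h.2, rfl⟩
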